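/- Let $N\ge 2$, let $\ell_1,\dots,\ell_N\in(0,\infty]$, $\omega_1,\dots,\omega_N\in\mathbb R$, and let $V_j:(0,\ell_j)\to\mathbb R$ be measurable with $V_j\in L^1(0,b)$ for every finite $b\le \ell_j$. For every $j$ with $\ell_j=\infty$ assume that $-\frac{d^2}{dx^2}+V_j$ is in the limit point case at infinity. For $\alpha\in\mathbb R\cup\{\infty\}$ let $H_\alpha=H_\alpha(V)$ be the operator $\{\psi_j\}\mapsto\{-\psi_j''+V_j\psi_j\}$ in $\bigoplus_{j=1}^N L^2(0,\ell_j)$ whose domain consists of all $\{\psi_j\}$ in this space such that $\psi_j,\psi_j'$ are locally absolutely continuous on $(0,\ell_j)$, $-\psi_j''+V_j\psi_j\in L^2(0,\ell_j)$, $\psi_j(\ell_j)\cos\omega_j+\psi_j'(\ell_j)\sin\omega_j=0$ whenever $\ell_j<\infty$, and, at the vertex, $\psi_1(0+)=\dots=\psi_N(0+)=:\psi$ and $\sum_{j}\psi_j'(0+)=\alpha\psi$ if $\alpha\in\mathbb R$, respectively $\psi_j(0+)=0$ for all $j$ if $\alpha=\infty$. Let $\alpha\in\mathbb R$ and let $k\in\mathbb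 C$ satisfy $\operatorname{Im}k\ge0$ and $k^2\in\rho(H_\infty)\cap\rho(H_\alpha)$. Then for each $j$ the equation $-\psi''+V_j\psi=k^2\psi$ on $(0,\ell_j)$ has a nontrivial solution $u_j$ with $u_j(0)=0$, and a nontrivial solution $v_j$ which is square integrable at infinity if $\ell_j=\infty$ and satisfies the boundary condition $v_j(\ell_j)\cos\omega_j+v_j'(\ell_j)\sin\omega_j=0$ if $\ell_j<\infty$. For any such solutions, the boundary values $v_j(0)$, $v_j'(0)$ exist, $v_j(0)\ne0$, the Wronskian $W(u_j,v_j)=u_jv_j'-u_j'v_j$ is a nonzero constant on $(0,\ell_j)$, and, with $$M(k):=\sum_{j=1}^N\frac{v_j'(0)}{v_j(0)},\qquad g_j(x,y;k):=-\frac{u_j(\min\{x,y\})\,v_j(\max\{x,y\})}{W(u_j,v_j)},$$ one has $\alpha\ne M(k)$, and the resolvent $(H_\alpha-k^2)^{-1}$ is the matrix integral operator with the kernel $$G^\alpha_{j\ell}(x,y;k)=\delta_{j\ell}\,g_j(x,y;k)+\frac{v_j(x)\,v_\ell(y)}{v_j(0)\,v_\ell(0)\,(\alpha-M(k))},$$ that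 is, for every $\varphi$ in the space and every $j$, $\big((H_\alpha-k^2)^{-1}\varphi\big)_j(x)=\sum_{\ell=1}^N\int_0^{\ell_\ell}G^\alpha_{j\ell}(x,y;k)\,\varphi_\ell(y)\,dy$ for almost every $x\in(0,\ell_j)$, with absolutely convergent integrals. -/

import Mathlib

open MeasureTheory Filter Topology Set

noncomputable section

namespace StarGraph

/-- The open interval `(0, L)` carrying a link of length `L ∈ (0, ∞]`. -/
def link (L : EReal) : Set ℝ := {x : ℝ | 0 < x ∧ (x : EReal) < L}

/-- `-f'' + V f = φ` on the open interval `s`, in the Carathéodory sense: `f` and `f'` are locally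
absolutely continuous on `s` and the equation holds almost everywhere.
(As `f'` is continuous on `s`, local absolute continuity of `f` is automatic.) -/
structure SolvesOn (s : Set ℝ) (V : ℝ → ℝ) (φ f : ℝ → ℂ) : Prop where
  diff : DifferentiableOn ℝ f s
  ac : ∀ a ∈ s, ∀ b ∈ s, AbsolutelyContinuousOnInterval (deriv f) a b
  eqn : ∀ᵐ x ∂volume.restrict s, HasDerivAt (deriv f) ((V x : ℂ) * f x - φ x) x

/-- `V` is integrable on every bounded interval `(0, b)` contained in the link.
Hence the vertex, and the other end of the link if it is at finite distance, are regular
endpoints, at which boundary values of functions and of their derivatives exist. -/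
def LocIntegrable (L : EReal) (V : ℝ → ℝ) : Prop :=
  ∀ b : ℝ, (b : EReal) ≤ L → IntegrableOn V (Ioo 0 b)

/-- `f` is square integrable at infinity. -/
def SqIntegrableAtInfinity (f : ℝ → ℂ) : Prop :=
  ∃ c : ℝ, 0 < c ∧ MemLp f 2 (volume.restrict (Ioi c))

/-- `-d²/dx² + V` on `(0, ∞)` is in the limit circle case at infinity: for every `z`, all solutions
of `-f'' + V f = z f` are square integrable at infinity. -/
def LimitCircleAtInfinity (V : ℝ → ℝ) : Prop :=
  ∀ (z : ℂ) (f : ℝ → ℂ), SolvesOn (Ioi 0) V (fun x => z * f x) f → SqIntegrableAtInfinity f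

/-- The limit point case at infinity: the alternative to the limit circle case. -/
def LimitPointAtInfinity (V : ℝ → ℝ) : Prop := ¬ LimitCircleAtInfinity V

/-- The boundary condition `f(L) cos ω + f'(L) sin ω = 0` at the outer end of a link of finite
length `L`; no condition if `L = ∞`. -/
def EndCondition (L : EReal) (ω : ℝ) (f : ℝ → ℂ) : Prop :=
  ∀ b : ℝ, L = (b : EReal) → ∃ c d : ℂ, Tendsto f (𝓝[<] b) (𝓝 c) ∧
    Tendsto (deriv f) (𝓝[<] b) (𝓝 d) ∧ c * (Real.cos ω : ℂ) + d * (Real.sin ω : ℂ) = 0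

/-- The condition at the vertex. For `α = ∞`: the Dirichlet condition on each link. For real `α`:
the boundary values `ψ_j(0+)` have a common value `p` and `∑ ψ_j'(0+) = α p`. -/
def VertexCondition {N : ℕ} : OnePoint ℝ → (Fin N → ℝ → ℂ) → Prop
  | none, f => ∀ j, Tendsto (f j) (𝓝[>] 0) (𝓝 0)
  | some α, f => ∃ (p : ℂ) (d : Fin N → ℂ), (∀ j, Tendsto (f j) (𝓝[>] 0) (𝓝 p)) ∧
      (∀ j, Tendsto (deriv (f j)) (𝓝[>] 0) (𝓝 (d j))) ∧ ∑ j, d j = (α : ℂ) * p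

/-- The state space `⨁_j L²(0, ℓ_j)`. -/
abbrev StateSpace {N : ℕ} (ℓ : Fin N → EReal) : Type :=
  PiLp 2 (fun j : Fin N => Lp ℂ 2 (volume.restrict (link (ℓ j))))

theorem link_eq_inter (L : EReal) : link L = Ioi 0 ∩ (Real.toEReal ⁻¹' Iio L) := rfl

theorem isOpen_link (L : EReal) : IsOpen (link L) :=
  isOpen_Ioi.inter (isOpen_Iio.preimage continuous_coe_real_ereal)

theorem uIcc_subset_link {L : EReal} {a b : ℝ} (ha : a ∈ link L) (hb : b ∈ link L) :
    uIcc a b ⊆ link L := by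
  intro x hx
  rw [uIcc, mem_Icc] at hx
  refine ⟨lt_of_lt_of_le (lt_min ha.1 hb.1) hx.1, ?_⟩
  refine lt_of_le_of_lt (EReal.coe_le_coe_iff.2 hx.2) ?_
  rcases max_choice a b with h | h <;> rw [h]
  exacts [ha.2, hb.2]

theorem link_mem_nhdsGT {L : EReal} (hL : 0 < L) : link L ∈ 𝓝[>] (0 : ℝ) := by
  refine inter_mem self_mem_nhdsWithin (mem_nhdsWithin_of_mem_nhds ?_)
  exact (isOpen_Iio.preimage continuous_coe_real_ereal).mem_nhds (by simpa using hL)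

theorem link_mem_nhdsLT {L : EReal} {b : ℝ} (hL : 0 < L) (hb : L = b) : link L ∈ 𝓝[<] b := by
  subst hb
  have hb : (0 : ℝ) < b := by exact_mod_cast hL
  refine inter_mem (mem_nhdsWithin_of_mem_nhds (Ioi_mem_nhds hb)) ?_
  filter_upwards [self_mem_nhdsWithin] with x hx
  exact EReal.coe_lt_coe_iff.2 hx

theorem ac_congr {f g : ℝ → ℂ} {a b : ℝ} (h : EqOn f g (uIcc a b))
    (hf : AbsolutelyContinuousOnInterval f a b) : AbsolutelyContinuousOnInterval g a b := by
  rw [absolutelyContinuousOnInterval_iff] at hf ⊢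
  intro ε hε
  obtain ⟨δ, hδ, H⟩ := hf ε hε
  refine ⟨δ, hδ, fun E hE hlt => ?_⟩
  convert H E hE hlt using 1
  refine Finset.sum_congr rfl fun i hi => ?_
  have hi' := hE.1 i hi
  rw [h hi'.1, h hi'.2]

theorem SolvesOn.deriv_add {L : EReal} {V : ℝ → ℝ} {φ χ f g : ℝ → ℂ}
    (hf : SolvesOn (link L) V φ f) (hg : SolvesOn (link L) V χ g) {x : ℝ} (hx : x ∈ link L) :
    deriv (f + g) x = deriv f x + deriv g x :=
  _root_.deriv_add ((hf.diff x hx).differentiableAt ((isOpen_link L).mem_nhds hx))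
    ((hg.diff x hx).differentiableAt ((isOpen_link L).mem_nhds hx))

theorem SolvesOn.deriv_smul {L : EReal} {V : ℝ → ℝ} {φ f : ℝ → ℂ} (c : ℂ)
    (hf : SolvesOn (link L) V φ f) {x : ℝ} (hx : x ∈ link L) :
    deriv (c • f) x = c • deriv f x :=
  deriv_const_smul c ((hf.diff x hx).differentiableAt ((isOpen_link L).mem_nhds hx))

theorem SolvesOn.add {L : EReal} {V : ℝ → ℝ} {φ χ f g : ℝ → ℂ} (hf : SolvesOn (link L) V φ f)
    (hg : SolvesOn (link L) V χ g) : SolvesOn (link L) V (φ + χ) (f + g) := by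
  have hd : EqOn (deriv f + deriv g) (deriv (f + g)) (link L) := fun x hx =>
    (hf.deriv_add hg hx).symm
  refine ⟨hf.diff.add hg.diff, fun a ha b hb => ?_, ?_⟩
  · exact ac_congr (hd.mono (uIcc_subset_link ha hb)) ((hf.ac a ha b hb).add (hg.ac a ha b hb))
  · filter_upwards [hf.eqn, hg.eqn, ae_restrict_mem (isOpen_link L).measurableSet] with x h1 h2 hx
    have h3 := (h1.add h2).congr_of_eventuallyEq
      (hd.symm.eventuallyEq_of_mem ((isOpen_link L).mem_nhds hx))
    refine h3.congr_deriv ?_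
    change _ = (V x : ℂ) * (f x + g x) - (φ x + χ x)
    ring

theorem SolvesOn.smul {L : EReal} {V : ℝ → ℝ} {φ f : ℝ → ℂ} (c : ℂ)
    (hf : SolvesOn (link L) V φ f) : SolvesOn (link L) V (c • φ) (c • f) := by
  have hd : EqOn (c • deriv f) (deriv (c • f)) (link L) := fun x hx =>
    (hf.deriv_smul c hx).symm
  refine ⟨hf.diff.const_smul c, fun a ha b hb => ?_, ?_⟩
  · exact ac_congr (hd.mono (uIcc_subset_link ha hb)) ((hf.ac a ha b hb).const_smul c)
  · filter_upwards [hf.eqn, ae_restrict_mem (isOpen_link L).measurableSet] with x h1 hx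
    have h3 := (h1.const_smul c).congr_of_eventuallyEq
      (hd.symm.eventuallyEq_of_mem ((isOpen_link L).mem_nhds hx))
    refine h3.congr_deriv ?_
    change c * _ = (V x : ℂ) * (c * f x) - c * φ x
    ring

theorem SolvesOn.congr_rhs {s : Set ℝ} {V : ℝ → ℝ} {φ χ f : ℝ → ℂ} (hf : SolvesOn s V φ f)
    (h : φ =ᵐ[volume.restrict s] χ) : SolvesOn s V χ f := by
  refine ⟨hf.diff, hf.ac, ?_⟩
  filter_upwards [hf.eqn, h] with x h1 h2
  rwa [← h2]

/-- `ψ` lies in the domain of `H_α(V)` and `H_α(V) ψ = φ`: the components of `ψ` have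
representatives `f_j` with `f_j`, `f_j'` locally absolutely continuous on the links and
`-f_j'' + V_j f_j = φ_j ∈ L²`, which satisfy the conditions at the outer ends of the links
of finite length and at the vertex. -/
def Acts {N : ℕ} (ℓ : Fin N → EReal) (V : Fin N → ℝ → ℝ) (ω : Fin N → ℝ) (α : OnePoint ℝ)
    (ψ φ : StateSpace ℓ) : Prop :=
  ∃ f : Fin N → ℝ → ℂ,
    (∀ j, ⇑(ψ j) =ᵐ[volume.restrict (link (ℓ j))] f j) ∧
    (∀ j, SolvesOn (link (ℓ j)) (V j) (φ j) (f j)) ∧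
    (∀ j, EndCondition (ℓ j) (ω j) (f j)) ∧
    VertexCondition α f

theorem EndCondition.add {L : EReal} (hL : 0 < L) {V : ℝ → ℝ} {ω : ℝ} {φ χ f g : ℝ → ℂ}
    (hf : SolvesOn (link L) V φ f) (hg : SolvesOn (link L) V χ g)
    (h1 : EndCondition L ω f) (h2 : EndCondition L ω g) : EndCondition L ω (f + g) := by
  intro b hb
  obtain ⟨c, d, hc, hd, h⟩ := h1 b hb
  obtain ⟨c', d', hc', hd', h'⟩ := h2 b hb
  refine ⟨c + c', d + d', hc.add hc', (hd.add hd').congr' ?_, by linear_combination h + h'⟩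
  filter_upwards [link_mem_nhdsLT hL hb] with x hx
  exact (hf.deriv_add hg hx).symm

theorem EndCondition.smul {L : EReal} (hL : 0 < L) {V : ℝ → ℝ} {ω : ℝ} {φ f : ℝ → ℂ} (a : ℂ)
    (hf : SolvesOn (link L) V φ f) (h1 : EndCondition L ω f) : EndCondition L ω (a • f) := by
  intro b hb
  obtain ⟨c, d, hc, hd, h⟩ := h1 b hb
  refine ⟨a • c, a • d, hc.const_smul a, (hd.const_smul a).congr' ?_, ?_⟩
  · filter_upwards [link_mem_nhdsLT hL hb] with x hx
    exact (hf.deriv_smul a hx).symm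
  · simp only [smul_eq_mul]
    linear_combination a * h

theorem VertexCondition.add {N : ℕ} {ℓ : Fin N → EReal} (hℓ : ∀ j, 0 < ℓ j) {V : Fin N → ℝ → ℝ}
    {α : OnePoint ℝ} {φ χ f g : Fin N → ℝ → ℂ}
    (hf : ∀ j, SolvesOn (link (ℓ j)) (V j) (φ j) (f j))
    (hg : ∀ j, SolvesOn (link (ℓ j)) (V j) (χ j) (g j))
    (h1 : VertexCondition α f) (h2 : VertexCondition α g) : VertexCondition α (f + g) := by
  cases α with
  | infty =>
    intro j
    have h := (h1 j).add (h2 j)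
    rw [add_zero] at h
    exact h
  | coe α =>
    obtain ⟨p, d, hp, hd, h⟩ := h1
    obtain ⟨p', d', hp', hd', h'⟩ := h2
    refine ⟨p + p', d + d', fun j => (hp j).add (hp' j), fun j => ?_, ?_⟩
    · refine ((hd j).add (hd' j)).congr' ?_
      filter_upwards [link_mem_nhdsGT (hℓ j)] with x hx
      exact ((hf j).deriv_add (hg j) hx).symm
    · simp only [Pi.add_apply, Finset.sum_add_distrib]
      linear_combination h + h'

theorem VertexCondition.smul {N : ℕ} {ℓ : Fin N → EReal} (hℓ : ∀ j, 0 < ℓ j)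
    {V : Fin N → ℝ → ℝ} {α : OnePoint ℝ} {φ f : Fin N → ℝ → ℂ} (a : ℂ)
    (hf : ∀ j, SolvesOn (link (ℓ j)) (V j) (φ j) (f j))
    (h1 : VertexCondition α f) : VertexCondition α (a • f) := by
  cases α with
  | infty =>
    intro j
    have h := (h1 j).const_smul a
    rw [smul_zero] at h
    exact h
  | coe α =>
    obtain ⟨p, d, hp, hd, h⟩ := h1
    refine ⟨a • p, a • d, fun j => (hp j).const_smul a, fun j => ?_, ?_⟩
    · refine ((hd j).const_smul a).congr' ?_
      filter_upwards [link_mem_nhdsGT (hℓ j)] with x hx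
      exact ((hf j).deriv_smul a hx).symm
    · simp only [Pi.smul_apply, smul_eq_mul, ← Finset.mul_sum]
      linear_combination a * h

theorem SolvesOn.zero (L : EReal) (V : ℝ → ℝ) : SolvesOn (link L) V 0 0 := by
  have hd : deriv (0 : ℝ → ℂ) = fun _ => 0 := by
    funext x
    exact deriv_const x (0 : ℂ)
  refine ⟨differentiableOn_const 0, fun a _ b _ => ?_, ?_⟩
  · rw [hd]
    exact (LipschitzWith.const (0 : ℂ)).lipschitzOnWith.absolutelyContinuousOnInterval
  · rw [hd]
    refine Eventually.of_forall fun x => ?_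
    simpa using hasDerivAt_const x (0 : ℂ)

/-- The graph of the operator `H_α(V)`. -/
def hamiltonianGraph {N : ℕ} (ℓ : Fin N → EReal) (hℓ : ∀ j, 0 < ℓ j) (V : Fin N → ℝ → ℝ)
    (ω : Fin N → ℝ) (α : OnePoint ℝ) : Submodule ℂ (StateSpace ℓ × StateSpace ℓ) where
  carrier := {p | Acts ℓ V ω α p.1 p.2}
  add_mem' := by
    rintro ⟨ψ, φ⟩ ⟨ψ', φ'⟩ ⟨f, hf, hs, he, hv⟩ ⟨g, hg, hs', he', hv'⟩
    refine ⟨f + g, fun j => ?_, fun j => ?_, fun j => (he j).add (hℓ j) (hs j) (hs' j) (he' j),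
      hv.add hℓ hs hs' hv'⟩
    · exact (Lp.coeFn_add (ψ j) (ψ' j)).trans ((hf j).add (hg j))
    · exact ((hs j).add (hs' j)).congr_rhs (Lp.coeFn_add (φ j) (φ' j)).symm
  zero_mem' := by
    refine ⟨0, fun j => Lp.coeFn_zero _ _ _, fun j => ?_, fun j => ?_, ?_⟩
    · exact (SolvesOn.zero (ℓ j) (V j)).congr_rhs (Lp.coeFn_zero _ _ _).symm
    · intro b _
      refine ⟨0, 0, tendsto_const_nhds, ?_, by simp⟩
      simp only [Pi.zero_apply]
      rw [show deriv (0 : ℝ → ℂ) = fun _ => 0 from funext fun x => deriv_const x (0 : ℂ)]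
      exact tendsto_const_nhds
    · cases α with
      | infty => exact fun j => tendsto_const_nhds
      | coe α =>
        refine ⟨0, 0, fun j => tendsto_const_nhds, fun j => ?_, by simp⟩
        simp only [Pi.zero_apply]
        rw [show deriv (0 : ℝ → ℂ) = fun _ => 0 from funext fun x => deriv_const x (0 : ℂ)]
        exact tendsto_const_nhds
  smul_mem' := by
    rintro a ⟨ψ, φ⟩ ⟨f, hf, hs, he, hv⟩
    refine ⟨a • f, fun j => ?_, fun j => ?_, fun j => (he j).smul (hℓ j) a (hs j),
      hv.smul hℓ a hs⟩
    · exact (Lp.coeFn_smul a (ψ j)).trans ((hf j).const_smul a)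
    · exact ((hs j).smul a).congr_rhs (Lp.coeFn_smul a (φ j)).symm

/-- The graph is that of a (single-valued) operator. -/
theorem hamiltonianGraph_single {N : ℕ} (ℓ : Fin N → EReal) (hℓ : ∀ j, 0 < ℓ j)
    (V : Fin N → ℝ → ℝ) (ω : Fin N → ℝ) (α : OnePoint ℝ) (p : StateSpace ℓ × StateSpace ℓ)
    (hp : p ∈ hamiltonianGraph ℓ hℓ V ω α) (h0 : p.1 = 0) : p.2 = 0 := by
  obtain ⟨ψ, φ⟩ := p
  obtain ⟨f, hf, hs, -, -⟩ := hp
  simp only at h0 hf hs ⊢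
  subst h0
  ext1 j
  refine Lp.ext ?_
  have hfz : f j =ᵐ[volume.restrict (link (ℓ j))] fun _ => 0 :=
    (hf j).symm.trans (Lp.coeFn_zero _ _ _)
  have hz : EqOn (f j) (fun _ => 0) (link (ℓ j)) :=
    Measure.eqOn_open_of_ae_eq hfz (isOpen_link _) (hs j).diff.continuousOn continuousOn_const
  have hd : EqOn (deriv (f j)) (fun _ => 0) (link (ℓ j)) := fun x hx => by
    rw [(hz.eventuallyEq_of_mem ((isOpen_link _).mem_nhds hx)).deriv_eq]
    exact deriv_const x 0
  refine EventuallyEq.trans ?_ (Lp.coeFn_zero _ _ _).symm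
  filter_upwards [(hs j).eqn, ae_restrict_mem (isOpen_link (ℓ j)).measurableSet] with x h1 hx
  have h2 : HasDerivAt (deriv (f j)) 0 x := (hasDerivAt_const x (0 : ℂ)).congr_of_eventuallyEq
    (hd.eventuallyEq_of_mem ((isOpen_link _).mem_nhds hx))
  have h3 := h1.unique h2
  rw [hz hx] at h3
  simpa using h3

/-- The Schrödinger operator `H_α(V)` on the star graph, for `α ∈ ℝ ∪ {∞}`, as an unbounded
operator in `⨁_j L²(0, ℓ_j)`. -/
def hamiltonian {N : ℕ} (ℓ : Fin N → EReal) (hℓ : ∀ j, 0 < ℓ j) (V : Fin N → ℝ → ℝ)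
    (ω : Fin N → ℝ) (α : OnePoint ℝ) : StateSpace ℓ →ₗ.[ℂ] StateSpace ℓ :=
  (hamiltonianGraph ℓ hℓ V ω α).toLinearPMap

theorem hamiltonian_graph {N : ℕ} (ℓ : Fin N → EReal) (hℓ : ∀ j, 0 < ℓ j) (V : Fin N → ℝ → ℝ)
    (ω : Fin N → ℝ) (α : OnePoint ℝ) :
    (hamiltonian ℓ hℓ V ω α).graph = hamiltonianGraph ℓ hℓ V ω α :=
  Submodule.toLinearPMap_graph_eq _ (hamiltonianGraph_single ℓ hℓ V ω α)

/-- `R = (T - z)⁻¹` for an unbounded operator `T`: `R` is a bounded, everywhere defined two-sided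
inverse of `T - z : D(T) → E`. -/
def IsResolventAt {E : Type*} [NormedAddCommGroup E] [NormedSpace ℂ E] (T : E →ₗ.[ℂ] E) (z : ℂ)
    (R : E →L[ℂ] E) : Prop :=
  (∀ φ : E, ∃ ψ : T.domain, (ψ : E) = R φ ∧ T ψ - z • (ψ : E) = φ) ∧
    ∀ ψ : T.domain, R (T ψ - z • (ψ : E)) = ψ

/-- The resolvent set `ρ(T)` of an unbounded operator. -/
def resolventSet {E : Type*} [NormedAddCommGroup E] [NormedSpace ℂ E] (T : E →ₗ.[ℂ] E) : Set ℂ :=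
  {z | ∃ R : E →L[ℂ] E, IsResolventAt T z R}

/-- `R` is the matrix integral operator with the kernel `G`:
`(R φ)_j(x) = ∑_l ∫_0^{ℓ_l} G_{jl}(x, y) φ_l(y) dy` for a.e. `x`, all integrals being absolutely
convergent. -/
def IsMatrixIntegralOperator {N : ℕ} (ℓ : Fin N → EReal) (R : StateSpace ℓ →L[ℂ] StateSpace ℓ)
    (G : Fin N → Fin N → ℝ → ℝ → ℂ) : Prop :=
  ∀ (φ : StateSpace ℓ) (j : Fin N), ∀ᵐ x ∂volume.restrict (link (ℓ j)),
    (∀ l, IntegrableOn (fun y => G j l x y * φ l y) (link (ℓ l))) ∧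
      R φ j x = ∑ l, ∫ y in link (ℓ l), G j l x y * φ l y

/-- `u` is a nontrivial solution of `-u'' + V u = z u` on the link with `u(0) = 0`. -/
structure IsVertexSolution (L : EReal) (V : ℝ → ℝ) (z : ℂ) (u : ℝ → ℂ) : Prop where
  solves : SolvesOn (link L) V (fun x => z * u x) u
  nontrivial : ∃ x ∈ link L, u x ≠ 0
  vertex : Tendsto u (𝓝[>] 0) (𝓝 0)

/-- `v` is a nontrivial solution of `-v'' + V v = z v` on the link which is square integrable at
infinity if `L = ∞` and satisfies the fixed boundary condition at `L` otherwise. -/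
structure IsEndSolution (L : EReal) (V : ℝ → ℝ) (ω : ℝ) (z : ℂ) (v : ℝ → ℂ) : Prop where
  solves : SolvesOn (link L) V (fun x => z * v x) v
  nontrivial : ∃ x ∈ link L, v x ≠ 0
  sqIntegrable : L = ⊤ → SqIntegrableAtInfinity v
  endCondition : EndCondition L ω v

/-- The Wronskian `W(u, v) = u v' - u' v`, as a function of the point. -/
def wronskian (u v : ℝ → ℂ) (x : ℝ) : ℂ := u x * deriv v x - deriv u x * v x

/-- The Green function `-u(x_<) v(x_>) / W` of a link, `W` being the value of the Wronskian. -/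
def linkGreen (u v : ℝ → ℂ) (W : ℂ) (x y : ℝ) : ℂ := -(u (min x y) * v (max x y) / W)

end StarGraph

end

noncomputable section

namespace StarGraph

/-! The formula is Krein's: with `z = k ^ 2`, solve `(H_α - z) f = φ` link by link with the
Dirichlet Green function and correct by a multiple of `v_j`. The Green part vanishes at the vertex
and has derivative `(∫ v_j φ_j) / v_j(0)` there. A common vertex value `p` forces the correction `p
v_j / v_j(0)`, and the derivative condition becomes `S + p M = α p` with `S = ∑ (∫ v_l φ_l) /
v_l(0)`, so `p = S / (α - M)`: this is the rank-one term of the kernel.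

For sources of bounded support the resulting `f` is proportional to `v_j` far out, hence lies in the
domain, and injectivity of `H_α - z` identifies it with the resolvent
(`IsResolventAt.ae_eq_starGreen`). General sources follow by truncation: the resolvent is bounded
and the kernel is square integrable in `y` for each `x`.

The ingredients come from the two resolvent sets. An end solution is the tail of `(H_∞ - z)⁻¹`
applied to a suitable source of bounded support. If `v_j(0) = 0`, then `v_j` is an eigenfunction of
`H_∞`; if `α = M`, the functions `v_j / v_j(0)` form one of `H_α`.

Extending the potentials by zero to the line turns boundary values into values at interior points.
Lagrange's identity and Cramer's rule for Wronskians (`wronskian_mul`) then yield uniqueness,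
extension and the Green function. -/

/-! ### Absolute continuity and a Volterra weight -/

theorem ac_of_dist_le {X Y : Type*} [PseudoMetricSpace X] [PseudoMetricSpace Y] {f : ℝ → X}
    {g : ℝ → Y} {a b K : ℝ} (hg : AbsolutelyContinuousOnInterval g a b)
    (h : ∀ x ∈ uIcc a b, ∀ y ∈ uIcc a b, dist (f x) (f y) ≤ K * dist (g x) (g y)) :
    AbsolutelyContinuousOnInterval f a b := by
  rw [absolutelyContinuousOnInterval_iff] at hg ⊢
  intro ε hε
  obtain ⟨δ, hδ, H⟩ := hg (ε / (|K| + 1)) (by positivity)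
  refine ⟨δ, hδ, fun E hE hlt => ?_⟩
  calc ∑ i ∈ Finset.range E.1, dist (f (E.2 i).1) (f (E.2 i).2)
      ≤ ∑ i ∈ Finset.range E.1, (|K| + 1) * dist (g (E.2 i).1) (g (E.2 i).2) := by
        refine Finset.sum_le_sum fun i hi => ?_
        have hi' := hE.1 i hi
        refine (h _ hi'.1 _ hi'.2).trans ?_
        have := le_abs_self K
        gcongr
        linarith
    _ = (|K| + 1) * ∑ i ∈ Finset.range E.1, dist (g (E.2 i).1) (g (E.2 i).2) := by
        rw [Finset.mul_sum]
    _ < (|K| + 1) * (ε / (|K| + 1)) := by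
        gcongr
        exact H E hE hlt
    _ = ε := by field_simp

theorem intervalIntegrable_of_locallyIntegrable {E : Type*} [NormedAddCommGroup E] {f : ℝ → E}
    (hf : LocallyIntegrable f volume) (a b : ℝ) : IntervalIntegrable f volume a b :=
  intervalIntegrable_iff.mpr
    ((hf.integrableOn_isCompact isCompact_uIcc).mono_set uIoc_subset_uIcc)

theorem ac_integral {E : Type*} [NormedAddCommGroup E] [NormedSpace ℝ E] {f : ℝ → E} {a b : ℝ}
    (hf : IntervalIntegrable f volume a b) :
    AbsolutelyContinuousOnInterval (fun x => ∫ t in a..x, f t) a b := by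
  refine ac_of_dist_le (K := 1)
    (hf.norm.absolutelyContinuousOnInterval_intervalIntegral (c := a) left_mem_uIcc) ?_
  intro x hx y hy
  have h1 : ∀ {x}, x ∈ uIcc a b → IntervalIntegrable f volume a x := fun {x} hx =>
    hf.mono_set (uIcc_subset_uIcc left_mem_uIcc hx)
  rw [dist_eq_norm, dist_eq_norm, intervalIntegral.integral_interval_sub_left (h1 hx) (h1 hy),
    intervalIntegral.integral_interval_sub_left (h1 hx).norm (h1 hy).norm, one_mul]
  exact intervalIntegral.norm_integral_le_abs_integral_norm

/-- `F` minus the primitive of `r` is absolutely continuous with derivative zero almost everywhere,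
hence constant. Derivatives of solutions are differentiable only almost everywhere, so this form of
the fundamental theorem is the one needed. -/
theorem ac_sub_eq_integral {E : Type*} [NormedAddCommGroup E] [NormedSpace ℝ E] [CompleteSpace E]
    {F r : ℝ → E} {a b : ℝ}
    (hF : AbsolutelyContinuousOnInterval F a b) (hr : IntervalIntegrable r volume a b)
    (hd : ∀ᵐ x, x ∈ uIcc a b → HasDerivAt F (r x) x) : F b - F a = ∫ t in a..b, r t := by
  have hac := hF.sub (ac_integral hr)
  obtain ⟨C, hC⟩ := hac.const_of_ae_hasDerivAt_zero (by
    filter_upwards [hd, hr.ae_hasDerivAt_integral] with x h1 h2 hx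
    simpa using (h1 hx).sub (h2 hx a left_mem_uIcc))
  have ha := hC a left_mem_uIcc
  have hb := hC b right_mem_uIcc
  simp only [Pi.sub_apply, intervalIntegral.integral_same, sub_zero] at ha hb
  rw [ha, ← hb]
  abel

theorem ac_comp_contDiff {f M : ℝ → ℝ} (hf : ContDiff ℝ 1 f) {a b : ℝ}
    (hM : AbsolutelyContinuousOnInterval M a b) :
    AbsolutelyContinuousOnInterval (fun x => f (M x)) a b := by
  obtain ⟨C, hC⟩ := hM.exists_bound
  obtain ⟨K, hK⟩ := hf.contDiffOn.exists_lipschitzOnWith (by decide) (convex_Icc (-C) C)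
    isCompact_Icc
  refine ac_of_dist_le (K := K) hM fun x hx y hy => ?_
  exact hK.dist_le_mul _ (abs_le.1 (hC x hx)) _ (abs_le.1 (hC y hy))

/-- A weight for which the Volterra operator with the density `m` is a contraction. -/
theorem exists_volterra_weight {m : ℝ → ℝ} (hm : LocallyIntegrable m volume) (a : ℝ) :
    ∃ w : ℝ → ℝ, Continuous w ∧ (∀ x, 1 ≤ w x) ∧ ∀ x, |∫ t in a..x, m t * w t| ≤ w x / 2 := by
  have hmi := intervalIntegrable_of_locallyIntegrable hm
  have hMc : Continuous fun x => ∫ t in a..x, m t :=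
    intervalIntegral.continuous_primitive hmi a
  set M : ℝ → ℝ := fun x => ∫ t in a..x, m t with hM
  -- With `w = 2 cosh (2M)`, the product `m w` is almost everywhere the derivative of `sinh (2M)`,
  -- and `|sinh| ≤ cosh = w / 2`. An even function serves both sides of `a`.
  have hwc : Continuous fun x => 2 * Real.cosh (2 * M x) := by fun_prop
  refine ⟨fun x => 2 * Real.cosh (2 * M x), hwc, fun x => ?_, fun x => ?_⟩
  · have := Real.one_le_cosh (2 * M x)
    linarith
  · have hc : ContDiff ℝ 1 fun y : ℝ => Real.sinh (2 * y) := by fun_prop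
    have h := ac_sub_eq_integral (a := a) (b := x) (ac_comp_contDiff hc (ac_integral (hmi a x)))
      ((hmi a x).mul_continuousOn hwc.continuousOn) (by
        filter_upwards [_root_.LocallyIntegrable.ae_hasDerivAt_integral hm] with y hy _
        refine (((hy a).const_mul 2).sinh).congr_deriv ?_
        ring)
    rw [← h]
    simp only [intervalIntegral.integral_same, mul_zero, Real.sinh_zero, sub_zero]
    rw [mul_div_cancel_left₀ _ (two_ne_zero), abs_le]
    have h1 := Real.cosh_sq (2 * M x)
    have h2 := Real.one_le_cosh (2 * M x)
    constructor <;> nlinarith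

/-! ### Initial value problems with locally integrable coefficients -/

open scoped BoundedContinuousFunction

/-- Existence for the inhomogeneous linear system `f' = g`, `g' = q f - φ` with locally integrable
coefficients, in integrated form. -/
theorem exists_integral_system {q φ : ℝ → ℂ} (hq : LocallyIntegrable q volume)
    (hφ : LocallyIntegrable φ volume) (a : ℝ) (c d : ℂ) :
    ∃ f g : ℝ → ℂ, Continuous f ∧ Continuous g ∧ (∀ x, f x = c + ∫ t in a..x, g t) ∧
      ∀ x, g x = d + ∫ t in a..x, (q t * f t - φ t) := by
  -- The density dominates the coefficients of both equations; the summand `‖φ‖` keeps the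
  -- contribution of the source bounded after division by the weight.
  have hm : LocallyIntegrable (fun t => 1 + ‖q t‖ + ‖φ t‖) volume :=
    ((locallyIntegrable_const 1).add fun x => (hq x).norm).add fun x => (hφ x).norm
  obtain ⟨w, hwc, hw1, hw⟩ := exists_volterra_weight hm a
  have hw0 : ∀ x, 0 < w x := fun x => zero_lt_one.trans_le (hw1 x)
  have hwne : ∀ x, (w x : ℂ) ≠ 0 := fun x => by exact_mod_cast (hw0 x).ne'
  have hwC : Continuous fun x => (w x : ℂ) := by fun_prop
  have hqi := intervalIntegrable_of_locallyIntegrable hq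
  have hφi := intervalIntegrable_of_locallyIntegrable hφ
  have hmwi : ∀ x y, IntervalIntegrable (fun t => (1 + ‖q t‖ + ‖φ t‖) * w t) volume x y :=
    fun x y => (intervalIntegrable_of_locallyIntegrable hm x y).mul_continuousOn hwc.continuousOn
  -- bound for the weighted Volterra operator
  have key : ∀ {r : ℝ → ℂ} {C : ℝ} (x : ℝ), 0 ≤ C →
      (∀ t, ‖r t‖ ≤ C * ((1 + ‖q t‖ + ‖φ t‖) * w t)) →
      ‖∫ t in a..x, r t‖ ≤ C * (w x / 2) := by
    intro r C x hC hr
    refine (intervalIntegral.norm_integral_le_abs_of_norm_le (Eventually.of_forall hr)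
      ((hmwi a x).const_mul C)).trans ?_
    rw [intervalIntegral.integral_const_mul, abs_mul, abs_of_nonneg hC]
    exact mul_le_mul_of_nonneg_left (hw x) hC
  have int1 : ∀ (h : ℝ →ᵇ ℂ × ℂ) (x y : ℝ),
      IntervalIntegrable (fun t => (w t : ℂ) * (h t).2) volume x y := fun h x y => by
    apply Continuous.intervalIntegrable
    fun_prop
  have int2 : ∀ (h : ℝ →ᵇ ℂ × ℂ) (x y : ℝ),
      IntervalIntegrable (fun t => q t * ((w t : ℂ) * (h t).1) - φ t) volume x y :=
    fun h x y => ((hqi x y).mul_continuousOn (by fun_prop)).sub (hφi x y)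
  have nfst : ∀ (h : ℝ →ᵇ ℂ × ℂ) t, ‖(h t).1‖ ≤ ‖h‖ := fun h t =>
    (norm_fst_le _).trans (h.norm_coe_le_norm t)
  have nsnd : ∀ (h : ℝ →ᵇ ℂ × ℂ) t, ‖(h t).2‖ ≤ ‖h‖ := fun h t =>
    (norm_snd_le _).trans (h.norm_coe_le_norm t)
  have nw : ∀ t, ‖(w t : ℂ)‖ = w t := fun t => by
    rw [Complex.norm_real, Real.norm_of_nonneg (hw0 t).le]
  have scale : ∀ {I e : ℂ} {C : ℝ} (x : ℝ), ‖I‖ ≤ C * (w x / 2) →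
      ‖(w x : ℂ)⁻¹ * (e + I)‖ ≤ ‖e‖ + C / 2 := by
    intro I e C x hI
    rw [norm_mul, norm_inv, nw, inv_mul_le_iff₀ (hw0 x)]
    refine (norm_add_le _ _).trans ?_
    have := mul_le_mul_of_nonneg_right (hw1 x) (norm_nonneg e)
    nlinarith
  have bd1 : ∀ (h : ℝ →ᵇ ℂ × ℂ) x, ‖(w x : ℂ)⁻¹ * (c + ∫ t in a..x, (w t : ℂ) * (h t).2)‖
      ≤ ‖c‖ + ‖h‖ / 2 := fun h x => scale x (key x (norm_nonneg h) fun t => by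
    rw [norm_mul, nw]
    have h0 := nsnd h t
    have h1 := hw0 t
    calc w t * ‖(h t).2‖ ≤ w t * ‖h‖ := by gcongr
      _ = ‖h‖ * (1 * w t) := by ring
      _ ≤ _ := by
        gcongr
        linarith [norm_nonneg (q t), norm_nonneg (φ t)])
  have bd2 : ∀ (h : ℝ →ᵇ ℂ × ℂ) x,
      ‖(w x : ℂ)⁻¹ * (d + ∫ t in a..x, (q t * ((w t : ℂ) * (h t).1) - φ t))‖
      ≤ ‖d‖ + (‖h‖ + 1) / 2 := fun h x => scale x (key x (by positivity) fun t => by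
    refine (norm_sub_le _ _).trans ?_
    rw [norm_mul, norm_mul, nw]
    have h0 := nfst h t
    have h1 := hw1 t
    have h2 := hw0 t
    have h3 : ‖q t‖ * (w t * ‖(h t).1‖) ≤ ‖q t‖ * (w t * ‖h‖) := by gcongr
    have h4 : ‖φ t‖ * 1 ≤ ‖φ t‖ * w t := by gcongr
    have h5 : 0 ≤ ‖h‖ * w t := by positivity
    have h6 : 0 ≤ ‖h‖ * w t * ‖φ t‖ := by positivity
    have h7 : 0 ≤ ‖q t‖ * w t := by positivity
    nlinarith)
  -- The unknown is `h = (f / w, g / w)`. In this weighted sup norm the Picard map is a contraction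
  -- on the whole line at once, so no continuation argument is required.
  let Φ : (ℝ →ᵇ ℂ × ℂ) → (ℝ →ᵇ ℂ × ℂ) := fun h =>
    BoundedContinuousFunction.ofNormedAddCommGroup
      (fun x => ((w x : ℂ)⁻¹ * (c + ∫ t in a..x, (w t : ℂ) * (h t).2),
        (w x : ℂ)⁻¹ * (d + ∫ t in a..x, (q t * ((w t : ℂ) * (h t).1) - φ t))))
      (((hwC.inv₀ hwne).mul (continuous_const.add
        (intervalIntegral.continuous_primitive (int1 h) a))).prodMk
        ((hwC.inv₀ hwne).mul (continuous_const.add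
        (intervalIntegral.continuous_primitive (int2 h) a))))
      (max (‖c‖ + ‖h‖ / 2) (‖d‖ + (‖h‖ + 1) / 2))
      (fun x => max_le_max (bd1 h x) (bd2 h x))
  have hΦ : ContractingWith (1 / 2) Φ := by
    refine ⟨by norm_num, LipschitzWith.of_dist_le_mul fun h k => ?_⟩
    rw [dist_eq_norm, dist_eq_norm]
    refine (BoundedContinuousFunction.norm_le (by positivity)).2 fun x => ?_
    have e1 : (Φ h x).1 - (Φ k x).1
        = (w x : ℂ)⁻¹ * (0 + ∫ t in a..x, (w t : ℂ) * ((h - k) t).2) := by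
      change (w x : ℂ)⁻¹ * (c + ∫ t in a..x, (w t : ℂ) * (h t).2)
        - (w x : ℂ)⁻¹ * (c + ∫ t in a..x, (w t : ℂ) * (k t).2) = _
      have : ∀ t, (w t : ℂ) * ((h - k) t).2 = (w t : ℂ) * (h t).2 - (w t : ℂ) * (k t).2 :=
        fun t => by simp [mul_sub]
      simp_rw [this]
      rw [intervalIntegral.integral_sub (int1 h a x) (int1 k a x)]
      ring
    have e2 : (Φ h x).2 - (Φ k x).2
        = (w x : ℂ)⁻¹ * (0 + ∫ t in a..x, q t * ((w t : ℂ) * ((h - k) t).1)) := by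
      change (w x : ℂ)⁻¹ * (d + ∫ t in a..x, (q t * ((w t : ℂ) * (h t).1) - φ t))
        - (w x : ℂ)⁻¹ * (d + ∫ t in a..x, (q t * ((w t : ℂ) * (k t).1) - φ t)) = _
      have : ∀ t, q t * ((w t : ℂ) * ((h - k) t).1)
          = (q t * ((w t : ℂ) * (h t).1) - φ t) - (q t * ((w t : ℂ) * (k t).1) - φ t) :=
        fun t => by simp [mul_sub]
      simp_rw [this]
      rw [intervalIntegral.integral_sub (int2 h a x) (int2 k a x)]
      ring
    have hn := norm_nonneg (h - k)
    refine max_le ?_ ?_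
    · change ‖(Φ h x).1 - (Φ k x).1‖ ≤ _
      rw [e1]
      refine (scale x (key x hn fun t => ?_)).trans (by simp; linarith)
      rw [norm_mul, nw]
      have h0 := nsnd (h - k) t
      have h1 := hw0 t
      calc w t * ‖((h - k) t).2‖ ≤ w t * ‖h - k‖ := by gcongr
        _ = ‖h - k‖ * (1 * w t) := by ring
        _ ≤ _ := by
          gcongr
          linarith [norm_nonneg (q t), norm_nonneg (φ t)]
    · change ‖(Φ h x).2 - (Φ k x).2‖ ≤ _
      rw [e2]
      refine (scale x (key x hn fun t => ?_)).trans (by simp; linarith)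
      rw [norm_mul, norm_mul, nw]
      have h0 := nfst (h - k) t
      have h1 := hw0 t
      calc ‖q t‖ * (w t * ‖((h - k) t).1‖) ≤ ‖q t‖ * (w t * ‖h - k‖) := by gcongr
        _ = ‖h - k‖ * (‖q t‖ * w t) := by ring
        _ ≤ _ := by
          gcongr
          linarith [norm_nonneg (φ t)]
  set h := ContractingWith.fixedPoint Φ hΦ
  have hfix : Φ h = h := hΦ.fixedPoint_isFixedPt
  have hx : ∀ x, (Φ h) x = h x := fun x => by rw [hfix]
  refine ⟨fun x => w x * (h x).1, fun x => w x * (h x).2, by fun_prop, by fun_prop,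
    fun x => ?_, fun x => ?_⟩
  · have := congrArg Prod.fst (hx x)
    change (w x : ℂ)⁻¹ * (c + ∫ t in a..x, (w t : ℂ) * (h t).2) = (h x).1 at this
    beta_reduce
    rw [← this, mul_inv_cancel_left₀ (hwne x)]
  · have := congrArg Prod.snd (hx x)
    change (w x : ℂ)⁻¹ * (d + ∫ t in a..x, (q t * ((w t : ℂ) * (h t).1) - φ t)) = (h x).2 at this
    beta_reduce
    rw [← this, mul_inv_cancel_left₀ (hwne x)]

/-- Existence for the inhomogeneous initial value problem on the line. -/
theorem exists_solvesOn_univ {V : ℝ → ℝ} (hV : LocallyIntegrable V volume) (z : ℂ) {φ : ℝ → ℂ}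
    (hφ : LocallyIntegrable φ volume) (a : ℝ) (c d : ℂ) :
    ∃ f : ℝ → ℂ, SolvesOn univ V (fun x => z * f x + φ x) f ∧ f a = c ∧ deriv f a = d := by
  have hq : LocallyIntegrable (fun t => (V t : ℂ) - z) volume :=
    LocallyIntegrable.sub (fun x => (hV x).imp fun _ h => ⟨h.1, h.2.ofReal⟩) (locallyIntegrable_const z)
  obtain ⟨f, g, hf, hg, h1, h2⟩ := exists_integral_system hq hφ a c d
  have hfg : ∀ x, HasDerivAt f (g x) x := fun x => by
    have := (intervalIntegral.integral_hasDerivAt_right (hg.intervalIntegrable a x)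
      hg.aestronglyMeasurable.stronglyMeasurableAtFilter hg.continuousAt).const_add c
    rwa [← funext h1] at this
  have hdf : deriv f = g := funext fun x => (hfg x).deriv
  have hr : LocallyIntegrable (fun t => ((V t : ℂ) - z) * f t - φ t) volume := by
    refine LocallyIntegrable.sub ?_ hφ
    rw [← locallyIntegrableOn_univ] at hq ⊢
    exact hq.mul_continuousOn hf.continuousOn isOpen_univ.isLocallyClosed
  have hri := intervalIntegrable_of_locallyIntegrable hr
  refine ⟨f, ⟨fun x _ => (hfg x).differentiableAt.differentiableWithinAt, fun x _ y _ => ?_, ?_⟩,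
    by simp [h1 a], by simp [hdf, h2 a]⟩
  · rw [hdf]
    refine ac_of_dist_le (K := 1) (ac_integral (hri x y)) fun s _ t _ => ?_
    rw [h2 s, h2 t, dist_add_left, one_mul, dist_eq_norm, dist_eq_norm,
      intervalIntegral.integral_interval_sub_left (hri _ _) (hri _ _),
      intervalIntegral.integral_interval_sub_left (hri _ _) (hri _ _)]
  · rw [Measure.restrict_univ]
    filter_upwards [_root_.LocallyIntegrable.ae_hasDerivAt_integral hr] with x hx
    have := (hx a).const_add d
    rw [← funext h2] at this
    rw [hdf]
    refine this.congr_deriv ?_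
    ring

/-! ### Lagrange's identity, uniqueness and extension of solutions -/

theorem SolvesOn.mono {s t : Set ℝ} {V : ℝ → ℝ} {φ f : ℝ → ℂ} (hf : SolvesOn s V φ f)
    (hts : t ⊆ s) : SolvesOn t V φ f :=
  ⟨hf.diff.mono hts, fun a ha b hb => hf.ac a (hts ha) b (hts hb),
    ae_restrict_of_ae_restrict_of_subset hts hf.eqn⟩

theorem SolvesOn.congr_potential {s : Set ℝ} (hs : MeasurableSet s) {V V' : ℝ → ℝ} {φ f : ℝ → ℂ}
    (hf : SolvesOn s V φ f) (h : EqOn V V' s) : SolvesOn s V' φ f := by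
  refine ⟨hf.diff, hf.ac, ?_⟩
  filter_upwards [hf.eqn, ae_restrict_mem hs] with x h1 hx
  rwa [← h hx]

theorem SolvesOn.hasDerivAt {s : Set ℝ} (hs : IsOpen s) {V : ℝ → ℝ} {φ f : ℝ → ℂ}
    (hf : SolvesOn s V φ f) {x : ℝ} (hx : x ∈ s) : HasDerivAt f (deriv f x) x :=
  ((hf.diff x hx).differentiableAt (hs.mem_nhds hx)).hasDerivAt

theorem SolvesOn.continuousOn_deriv {s : Set ℝ} (hs : IsOpen s) {V : ℝ → ℝ} {φ f : ℝ → ℂ}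
    (hf : SolvesOn s V φ f) : ContinuousOn (deriv f) s := by
  intro x hx
  obtain ⟨ε, hε, h⟩ := Metric.isOpen_iff.1 hs x hx
  have ha : x - ε / 2 ∈ s := h (by
    rw [Metric.mem_ball, Real.dist_eq, abs_lt]
    constructor <;> linarith)
  have hb : x + ε / 2 ∈ s := h (by
    rw [Metric.mem_ball, Real.dist_eq, abs_lt]
    constructor <;> linarith)
  refine ((hf.ac _ ha _ hb).continuousOn.continuousAt ?_).continuousWithinAt
  rw [uIcc_of_le (by linarith)]
  exact Icc_mem_nhds (by linarith) (by linarith)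

theorem SolvesOn.ac_self {s : Set ℝ} (hs : IsOpen s) [OrdConnected s] {V : ℝ → ℝ} {φ f : ℝ → ℂ}
    (hf : SolvesOn s V φ f) {a b : ℝ} (ha : a ∈ s) (hb : b ∈ s) :
    AbsolutelyContinuousOnInterval f a b := by
  have h1 : ContDiffOn ℝ (0 + 1) f s := (contDiffOn_succ_iff_deriv_of_isOpen hs).2
    ⟨hf.diff, by simp, contDiffOn_zero.2 (hf.continuousOn_deriv hs)⟩
  rw [zero_add] at h1
  exact (h1.mono (OrdConnected.uIcc_subset ‹_› ha hb)).absolutelyContinuousOnInterval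

/-- Lagrange's identity. -/
theorem SolvesOn.wronskian_sub {s : Set ℝ} (hs : IsOpen s) [OrdConnected s] {V : ℝ → ℝ} {z : ℂ}
    {φ f u : ℝ → ℂ} (hu : SolvesOn s V (fun x => z * u x) u)
    (hf : SolvesOn s V (fun x => z * f x + φ x) f) {a b : ℝ} (ha : a ∈ s) (hb : b ∈ s)
    (hφ : IntervalIntegrable φ volume a b) :
    wronskian u f b - wronskian u f a = -∫ t in a..b, u t * φ t := by
  have hab : uIcc a b ⊆ s := OrdConnected.uIcc_subset ‹_› ha hb
  have hac : AbsolutelyContinuousOnInterval (wronskian u f) a b :=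
    ((hu.ac_self hs ha hb).smul (hf.ac a ha b hb)).sub
      ((hu.ac a ha b hb).smul (hf.ac_self hs ha hb))
  rw [← intervalIntegral.integral_neg]
  refine ac_sub_eq_integral hac
    (hφ.continuousOn_mul (hu.diff.continuousOn.mono hab)).neg ?_
  filter_upwards [(ae_restrict_iff' hs.measurableSet).1 hu.eqn,
    (ae_restrict_iff' hs.measurableSet).1 hf.eqn] with x h1 h2 hx
  have h3 := ((hu.hasDerivAt hs (hab hx)).mul (h2 (hab hx))).sub
    ((h1 (hab hx)).mul (hf.hasDerivAt hs (hab hx)))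
  refine h3.congr_deriv ?_
  ring

theorem SolvesOn.wronskian_eq {s : Set ℝ} (hs : IsOpen s) [OrdConnected s] {V : ℝ → ℝ} {z : ℂ}
    {f u : ℝ → ℂ} (hu : SolvesOn s V (fun x => z * u x) u)
    (hf : SolvesOn s V (fun x => z * f x) f) {a b : ℝ} (ha : a ∈ s) (hb : b ∈ s) :
    wronskian u f b = wronskian u f a := by
  have h := hu.wronskian_sub hs (φ := fun _ => 0) (by simpa using hf) ha hb
    intervalIntegrable_const
  simpa [sub_eq_zero] using h

/-- Cramer's rule: where `u`, `v` have nonzero Wronskian, `f` is recovered from its Wronskians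
against them. Combined with Lagrange's identity, this takes the place of variation of constants. -/
theorem wronskian_mul (u v f : ℝ → ℂ) (x : ℝ) :
    f x * wronskian u v x = v x * wronskian u f x - u x * wronskian v f x := by
  unfold wronskian
  ring

/-- Solutions of the homogeneous equation on an interval extend to the line. -/
theorem SolvesOn.exists_extension {s : Set ℝ} (hs : IsOpen s) [OrdConnected s] {V : ℝ → ℝ}
    (hV : LocallyIntegrable V volume) {z : ℂ} {f : ℝ → ℂ} (hf : SolvesOn s V (fun x => z * f x) f)
    {a : ℝ} (ha : a ∈ s) :
    ∃ F, SolvesOn univ V (fun x => z * F x) F ∧ EqOn f F s := by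
  have h0 : LocallyIntegrable (fun _ : ℝ => (0 : ℂ)) volume := locallyIntegrable_const 0
  obtain ⟨u, hu, hua, hua'⟩ := exists_solvesOn_univ hV z h0 a 1 0
  obtain ⟨v, hv, hva, hva'⟩ := exists_solvesOn_univ hV z h0 a 0 1
  obtain ⟨F, hF, hFa, hFa'⟩ := exists_solvesOn_univ hV z h0 a (f a) (deriv f a)
  simp only [add_zero] at hu hv hF
  -- `f` and `F` have the same data at `a`, hence the same constant Wronskians against the basis
  -- `u`, `v`.
  refine ⟨F, hF, fun x hx => ?_⟩
  have hW : wronskian u v x = 1 := by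
    rw [hu.wronskian_eq isOpen_univ hv (mem_univ a) (mem_univ x), wronskian, hua, hua', hva, hva']
    ring
  have h1 : ∀ {w : ℝ → ℂ}, SolvesOn univ V (fun x => z * w x) w →
      wronskian w f x = wronskian w F x := by
    intro w hw
    rw [(hw.mono (subset_univ s)).wronskian_eq hs hf ha hx,
      hw.wronskian_eq isOpen_univ hF (mem_univ a) (mem_univ x), wronskian, wronskian, hFa, hFa']
  have e1 := wronskian_mul u v f x
  have e2 := wronskian_mul u v F x
  rw [hW, mul_one, h1 hu, h1 hv] at e1
  rw [hW, mul_one] at e2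
  rw [e1, e2]

/-- A solution of the homogeneous equation with vanishing data at a point is trivial. -/
theorem SolvesOn.eq_zero {V : ℝ → ℝ} (hV : LocallyIntegrable V volume) {z : ℂ} {f : ℝ → ℂ}
    (hf : SolvesOn univ V (fun x => z * f x) f) {a : ℝ} (h0 : f a = 0) (h1 : deriv f a = 0)
    (x : ℝ) : f x = 0 := by
  have h0' : LocallyIntegrable (fun _ : ℝ => (0 : ℂ)) volume := locallyIntegrable_const 0
  obtain ⟨u, hu, hua, hua'⟩ := exists_solvesOn_univ hV z h0' a 1 0
  obtain ⟨v, hv, hva, hva'⟩ := exists_solvesOn_univ hV z h0' a 0 1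
  simp only [add_zero] at hu hv
  have hW : wronskian u v x = 1 := by
    rw [hu.wronskian_eq isOpen_univ hv (mem_univ a) (mem_univ x), wronskian, hua, hua', hva, hva']
    ring
  have h2 : ∀ {w : ℝ → ℂ}, SolvesOn univ V (fun x => z * w x) w → wronskian w f x = 0 := by
    intro w hw
    rw [hw.wronskian_eq isOpen_univ hf (mem_univ a) (mem_univ x), wronskian, h0, h1]
    ring
  have e1 := wronskian_mul u v f x
  rw [hW, mul_one, h2 hu, h2 hv] at e1
  simpa using e1

/-! ### Links: extended potentials, square integrability, exhaustion -/

instance ordConnected_link (L : EReal) : OrdConnected (link L) :=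
  ⟨fun _ ha _ hb => Icc_subset_uIcc.trans (uIcc_subset_link ha hb)⟩

theorem link_coe (b : ℝ) : link (b : EReal) = Ioo 0 b := by
  ext x
  simp [link]

theorem link_top : link ⊤ = Ioi 0 := by
  ext x
  simp [link]

theorem link_nonempty {L : EReal} (hL : 0 < L) : (link L).Nonempty := by
  obtain ⟨x, hx0, hxL⟩ := EReal.exists_between_coe_real hL
  exact ⟨x, by exact_mod_cast hx0, hxL⟩

theorem link_inter_Iio_subset (L : EReal) (c : ℝ) :
    ∃ b : ℝ, (b : EReal) ≤ L ∧ link L ∩ Iio c ⊆ Ioo 0 b ∨ link L ∩ Iio c = ∅ := by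
  rcases le_total (c : EReal) L with h | h
  · exact ⟨c, Or.inl ⟨h, fun x hx => ⟨hx.1.1, hx.2⟩⟩⟩
  · induction L with
    | bot => exact ⟨0, Or.inr (by ext x; simp [link])⟩
    | top => simp at h
    | coe L => exact ⟨L, Or.inl ⟨le_rfl, by rw [link_coe]; exact inter_subset_left⟩⟩

/-- Extension by zero makes the vertex, and a finite outer end, interior points of the line, where
solutions and their derivatives are continuous. -/
theorem LocIntegrable.exists_extension {L : EReal} {V : ℝ → ℝ} (hV : LocIntegrable L V) :
    ∃ V' : ℝ → ℝ, LocallyIntegrable V' volume ∧ EqOn V V' (link L) := by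
  have hm := (isOpen_link L).measurableSet
  refine ⟨(link L).indicator V, fun x => ⟨Iio (x + 1), Iio_mem_nhds (by linarith), ?_⟩,
    fun x hx => (indicator_of_mem hx V).symm⟩
  rw [integrableOn_indicator_iff hm]
  obtain ⟨b, ⟨hb, h⟩ | h⟩ := link_inter_Iio_subset L (x + 1)
  · exact (hV b hb).mono_set h
  · rw [h]
    exact integrableOn_empty

/-- A continuous function is bounded on `[0, b]`, so only the tail matters; on a finite link the
choice `b = L` leaves no tail. -/
theorem memLp_link_of_tail {L : EReal} {f : ℝ → ℂ} (hf : Continuous f) {b : ℝ}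
    (h : MemLp f 2 (volume.restrict (link L ∩ Ioi b))) : MemLp f 2 (volume.restrict (link L)) := by
  have hm := (isOpen_link L).measurableSet
  have h1 : MemLp ((link L ∩ Ioi b).indicator f) 2 volume :=
    (memLp_indicator_iff_restrict (hm.inter measurableSet_Ioi)).2 h
  have h2 : MemLp ((Icc 0 b).indicator f) 2 volume := by
    rw [memLp_indicator_iff_restrict measurableSet_Icc]
    obtain ⟨C, hC⟩ := isCompact_Icc.exists_bound_of_continuousOn (hf.continuousOn (s := Icc 0 b))
    exact MemLp.of_bound hf.aestronglyMeasurable C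
      ((ae_restrict_iff' measurableSet_Icc).2 (Eventually.of_forall hC))
  refine (((h1.add h2).restrict (link L)).congr_norm hf.aestronglyMeasurable ?_)
  refine (ae_restrict_iff' hm).2 (Eventually.of_forall fun x hx => ?_)
  rcases lt_or_ge b x with hb | hb
  · have e1 : x ∈ link L ∩ Ioi b := ⟨hx, hb⟩
    have e2 : x ∉ Icc 0 b := fun h => absurd h.2 (not_le.2 hb)
    simp [e1, e2]
  · have e1 : x ∉ link L ∩ Ioi b := fun h => absurd h.2 (not_lt.2 hb)
    have e2 : x ∈ Icc 0 b := ⟨hx.1.le, hb⟩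
    simp [e1, e2]

theorem memLp_link_of_eqOn {L : EReal} {f v : ℝ → ℂ} (hf : Continuous f) {b : ℝ} {e : ℂ}
    (hv : MemLp v 2 (volume.restrict (link L))) (h : ∀ x ∈ link L, b < x → f x = e * v x) :
    MemLp f 2 (volume.restrict (link L)) := by
  refine memLp_link_of_tail hf (b := b) ?_
  refine ((hv.const_mul e).mono_measure (Measure.restrict_mono_set volume inter_subset_left)).ae_eq ?_
  exact (ae_restrict_iff' ((isOpen_link L).measurableSet.inter measurableSet_Ioi)).2
    (Eventually.of_forall fun x hx => (h x hx.1 hx.2).symm)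

theorem memLp_link_of_sqIntegrable {L : EReal} (hL : 0 < L) {f F : ℝ → ℂ} (hF : Continuous F)
    (hfF : EqOn f F (link L)) (h : L = ⊤ → SqIntegrableAtInfinity f) :
    MemLp F 2 (volume.restrict (link L)) := by
  induction L with
  | bot => simp at hL
  | coe b =>
    refine memLp_link_of_tail hF (b := b) ?_
    rw [link_coe, show Ioo 0 b ∩ Ioi b = ∅ by ext x; simp; intros; linarith]
    simp
  | top =>
    obtain ⟨c, hc, hfc⟩ := h rfl
    refine memLp_link_of_tail hF (b := c) ?_
    have hsub : link ⊤ ∩ Ioi c ⊆ Ioi c := inter_subset_right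
    refine (hfc.mono_measure (Measure.restrict_mono_set volume hsub)).ae_eq ?_
    exact (ae_restrict_iff' ((isOpen_link ⊤).measurableSet.inter measurableSet_Ioi)).2
      (Eventually.of_forall fun x hx => hfF hx.1)

/-- An exhaustion of a link by bounded intervals. -/
theorem exists_exhaustion {L : EReal} (hL : 0 < L) :
    ∃ b : ℕ → ℝ, (∀ n, b n ∈ link L) ∧ ∀ x ∈ link L, ∀ᶠ n in atTop, x ≤ b n := by
  obtain ⟨u, -, hu, hlim⟩ := exists_seq_strictMono_tendsto' hL
  have hcoe : ∀ n, ((u n).toReal : EReal) = u n := fun n =>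
    EReal.coe_toReal (ne_top_of_lt (hu n).2) (ne_bot_of_gt (hu n).1)
  refine ⟨fun n => (u n).toReal, fun n => ⟨?_, ?_⟩, fun x hx => ?_⟩
  · have := (hu n).1
    rw [← hcoe n] at this
    exact_mod_cast this
  · rw [hcoe]
    exact (hu n).2
  · filter_upwards [hlim.eventually_const_lt hx.2] with n hn
    rw [← hcoe n] at hn
    exact_mod_cast hn.le

/-- Dominated convergence with the majorant `|φ|²`; this gives density of sources of bounded
support. -/
theorem tendsto_toLp_indicator {μ : Measure ℝ} {φ : ℝ → ℂ} (hφ : MemLp φ 2 μ) {s : ℕ → Set ℝ}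
    (hs : ∀ n, MeasurableSet (s n)) (h : ∀ᵐ x ∂μ, ∀ᶠ n in atTop, x ∈ s n) :
    Tendsto (fun n => (hφ.indicator (hs n)).toLp ((s n).indicator φ)) atTop (𝓝 (hφ.toLp φ)) := by
  rw [Lp.tendsto_Lp_iff_tendsto_eLpNorm'']
  have h2 : (2 : ENNReal).toReal = 2 := by simp
  have hfin : ∫⁻ x, ‖φ x‖ₑ ^ (2 : ℝ) ∂μ ≠ ⊤ := by
    have := lintegral_rpow_enorm_lt_top_of_eLpNorm_lt_top (p := 2) (by simp) (by simp) hφ.2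
    rw [h2] at this
    exact this.ne
  have key : Tendsto (fun n => ∫⁻ x, ‖((s n).indicator φ - φ) x‖ₑ ^ (2 : ℝ) ∂μ) atTop (𝓝 0) := by
    have := tendsto_lintegral_of_dominated_convergence' (μ := μ)
      (F := fun n x => ‖((s n).indicator φ - φ) x‖ₑ ^ (2 : ℝ)) (f := fun _ => 0)
      (fun x => ‖φ x‖ₑ ^ (2 : ℝ)) (fun n => ?_) (fun n => Eventually.of_forall fun x => ?_) hfin ?_
    · simpa using this
    · exact (((hφ.1.indicator (hs n)).sub hφ.1).enorm).pow_const _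
    · by_cases hx : x ∈ s n <;> simp [hx]
    · filter_upwards [h] with x hx
      refine tendsto_const_nhds.congr' ?_
      filter_upwards [hx] with n hn
      simp [hn]
  simp_rw [eLpNorm_eq_lintegral_rpow_enorm_toReal (two_ne_zero) (ENNReal.ofNat_ne_top), h2]
  have := key.ennrpow_const (1 / 2)
  simpa using this

/-! ### The resolvent as a solution operator -/

section Resolvent

variable {N : ℕ} {ℓ : Fin N → EReal} {hℓ : ∀ j, 0 < ℓ j} {V : Fin N → ℝ → ℝ} {ω : Fin N → ℝ}
  {α : OnePoint ℝ} {z : ℂ} {R : StateSpace ℓ →L[ℂ] StateSpace ℓ}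

theorem IsResolventAt.acts (hR : IsResolventAt (hamiltonian ℓ hℓ V ω α) z R) (φ : StateSpace ℓ) :
    Acts ℓ V ω α (R φ) (φ + z • R φ) := by
  obtain ⟨ψ, h1, h2⟩ := hR.1 φ
  have h3 := (hamiltonian ℓ hℓ V ω α).mem_graph ψ
  rw [hamiltonian_graph] at h3
  rw [← h1, ← h2, sub_add_cancel]
  exact h3

/-- The left-inverse half of the definition: any explicit candidate in the domain that solves the
equation must be the resolvent. -/
theorem IsResolventAt.eq_of_acts (hR : IsResolventAt (hamiltonian ℓ hℓ V ω α) z R)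
    {φ ψ : StateSpace ℓ} (h : Acts ℓ V ω α ψ (φ + z • ψ)) : R φ = ψ := by
  have h1 : (ψ, φ + z • ψ) ∈ (hamiltonian ℓ hℓ V ω α).graph := by
    rw [hamiltonian_graph]
    exact h
  obtain ⟨y, hy1, hy2⟩ := (LinearPMap.mem_graph_iff _).1 h1
  have h2 := hR.2 y
  simp only at hy1 hy2
  rwa [hy2, hy1, add_sub_cancel_right] at h2

/-- A solution of `(H_α - z) f = φ` in the domain of `H_α` represents the resolvent at `φ`. -/
theorem IsResolventAt.ae_eq (hR : IsResolventAt (hamiltonian ℓ hℓ V ω α) z R)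
    (φ : StateSpace ℓ) {f : Fin N → ℝ → ℂ}
    (hf : ∀ j, MemLp (f j) 2 (volume.restrict (link (ℓ j))))
    (hs : ∀ j, SolvesOn (link (ℓ j)) (V j) (fun x => z * f j x + φ j x) (f j))
    (he : ∀ j, EndCondition (ℓ j) (ω j) (f j)) (hv : VertexCondition α f) (j : Fin N) :
    ⇑(R φ j) =ᵐ[volume.restrict (link (ℓ j))] f j := by
  set ψ : StateSpace ℓ := WithLp.toLp 2 fun j => (hf j).toLp (f j) with hψ
  have hψf : ∀ j, ⇑(ψ j) =ᵐ[volume.restrict (link (ℓ j))] f j := fun j => (hf j).coeFn_toLp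
  rw [hR.eq_of_acts (φ := φ) (ψ := ψ) ⟨f, hψf, fun j => (hs j).congr_rhs ?_, he, hv⟩]
  · exact hψf j
  · filter_upwards [hψf j, Lp.coeFn_add (φ j) (z • ψ j), Lp.coeFn_smul z (ψ j)] with x h1 h2 h3
    change _ = (φ j + z • ψ j : Lp ℂ 2 _) x
    rw [h2, Pi.add_apply, h3, Pi.smul_apply, h1, smul_eq_mul, add_comm]

/-- The case of zero source, which excludes eigenfunctions; continuity upgrades almost everywhere to
everywhere. -/
theorem IsResolventAt.eqOn_zero (hR : IsResolventAt (hamiltonian ℓ hℓ V ω α) z R)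
    {f : Fin N → ℝ → ℂ} (hf : ∀ j, MemLp (f j) 2 (volume.restrict (link (ℓ j))))
    (hs : ∀ j, SolvesOn (link (ℓ j)) (V j) (fun x => z * f j x) (f j))
    (he : ∀ j, EndCondition (ℓ j) (ω j) (f j)) (hv : VertexCondition α f) (j : Fin N) :
    EqOn (f j) 0 (link (ℓ j)) := by
  have h := hR.ae_eq 0 hf (fun j => (hs j).congr_rhs ?_) he hv j
  · rw [map_zero] at h
    exact Measure.eqOn_open_of_ae_eq (h.symm.trans (Lp.coeFn_zero _ _ _)) (isOpen_link _)
      (hs j).diff.continuousOn continuousOn_const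
  · filter_upwards [Lp.coeFn_zero ℂ 2 (volume.restrict (link (ℓ j)))] with x hx
    change _ = _ + (0 : Lp ℂ 2 (volume.restrict (link (ℓ j)))) x
    rw [hx]
    simp

end Resolvent

/-! ### Vertex values and existence of end solutions -/

theorem SolvesOn.continuous {V : ℝ → ℝ} {φ f : ℝ → ℂ} (hf : SolvesOn univ V φ f) : Continuous f :=
  continuousOn_univ.1 hf.diff.continuousOn

theorem SolvesOn.continuous_deriv {V : ℝ → ℝ} {φ f : ℝ → ℂ} (hf : SolvesOn univ V φ f) :
    Continuous (deriv f) :=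
  continuousOn_univ.1 (hf.continuousOn_deriv isOpen_univ)

theorem SolvesOn.eq_zero_of_eqOn {V : ℝ → ℝ} (hV : LocallyIntegrable V volume) {z : ℂ} {f : ℝ → ℂ}
    (hf : SolvesOn univ V (fun x => z * f x) f) {s : Set ℝ} (hs : IsOpen s) (hne : s.Nonempty)
    (h : EqOn f 0 s) (x : ℝ) : f x = 0 := by
  obtain ⟨a, ha⟩ := hne
  refine hf.eq_zero hV (h ha) ?_ x
  rw [h.deriv hs ha]
  exact deriv_const a 0

theorem tendsto_vertex {L : EReal} (hL : 0 < L) {f F : ℝ → ℂ} (hF : Continuous F)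
    (h : EqOn f F (link L)) : Tendsto f (𝓝[>] 0) (𝓝 (F 0)) := by
  refine (hF.continuousAt.tendsto.mono_left nhdsWithin_le_nhds).congr' ?_
  filter_upwards [link_mem_nhdsGT hL] with x hx
  exact (h hx).symm

theorem exists_isVertexSolution {L : EReal} (hL : 0 < L) {V V' : ℝ → ℝ}
    (hV' : LocallyIntegrable V' volume) (hVV' : EqOn V V' (link L)) (z : ℂ) :
    ∃ u, IsVertexSolution L V z u ∧ SolvesOn univ V' (fun x => z * u x) u ∧ u 0 = 0 := by
  obtain ⟨u, hu, hu0, hu1⟩ := exists_solvesOn_univ hV' z (φ := fun _ => 0)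
    (locallyIntegrable_const 0) 0 0 1
  simp only [add_zero] at hu
  refine ⟨u, ⟨(hu.mono (subset_univ _)).congr_potential (isOpen_link L).measurableSet hVV'.symm,
    ?_, ?_⟩, hu, hu0⟩
  · by_contra! h
    have h1 : u = fun _ => 0 :=
      funext (hu.eq_zero_of_eqOn hV' (isOpen_link L) (link_nonempty hL) h)
    rw [h1, deriv_const] at hu1
    exact zero_ne_one hu1
  · have := tendsto_vertex hL hu.continuous (fun x (_ : x ∈ link L) => rfl)
    rwa [hu0] at this

theorem EndCondition.of_eqOn {L : EReal} {ω : ℝ} {f v : ℝ → ℂ} (hv : EndCondition L ω v)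
    {b : ℝ} (hb : b ∈ link L) {e : ℂ} (h : ∀ x ∈ link L, b < x → f x = e * v x) :
    EndCondition L ω f := by
  intro c hc
  obtain ⟨p, q, hp, hq, hpq⟩ := hv c hc
  have hL : 0 < L := lt_trans (by exact_mod_cast hb.1) hb.2
  have hbc : b < c := by
    have := hb.2
    rw [hc] at this
    exact_mod_cast this
  have hmem : link L ∩ Ioi b ∈ 𝓝[<] c :=
    inter_mem (link_mem_nhdsLT hL hc) (mem_nhdsWithin_of_mem_nhds (Ioi_mem_nhds hbc))
  have hE : EqOn f (fun x => e * v x) (link L ∩ Ioi b) := fun x hx => h x hx.1 hx.2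
  refine ⟨e * p, e * q, (hp.const_mul e).congr' ?_, (hq.const_mul e).congr' ?_,
    by linear_combination e * hpq⟩
  · filter_upwards [hmem] with x hx
    exact (hE hx).symm
  · filter_upwards [hmem] with x hx
    rw [hE.deriv ((isOpen_link L).inter isOpen_Ioi) hx, deriv_const_mul_field]

theorem exists_mem_link_gt {L : EReal} {x : ℝ} (hx : x ∈ link L) : ∃ y ∈ link L, x < y := by
  obtain ⟨y, h1, h2⟩ := EReal.exists_between_coe_real hx.2
  have hxy : x < y := by exact_mod_cast h1
  exact ⟨y, ⟨hx.1.trans hxy, h2⟩, hxy⟩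

/-- If a solution of the inhomogeneous equation with source `conj u` on `(δ, b]` has the Dirichlet
value at the vertex, it does not vanish identically beyond `b`. -/
theorem exists_ne_zero_beyond {L : EReal} {V : ℝ → ℝ} (hV : LocallyIntegrable V volume) {z : ℂ}
    {u f : ℝ → ℂ} (hu : SolvesOn univ V (fun x => z * u x) u) (hu0 : u 0 = 0) {δ b x₁ : ℝ}
    (hδ : 0 < δ) (hx₁ : x₁ ∈ Ioo δ b) (hux₁ : u x₁ ≠ 0) (hb : b ∈ link L)
    (hf : SolvesOn (link L) V
      (fun x => z * f x + (Ioc δ b).indicator (fun y => (starRingEnd ℂ) (u y)) x) f)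
    (hf0 : Tendsto f (𝓝[>] 0) (𝓝 0)) : ∃ x ∈ link L ∩ Ioi b, f x ≠ 0 := by
  have hδb : δ < b := hx₁.1.trans hx₁.2
  have hδL : link (δ : EReal) ⊆ link L := by
    rw [link_coe]
    exact fun x hx => ⟨hx.1, lt_trans (by exact_mod_cast hx.2.trans hδb) hb.2⟩
  -- If `f` vanished beyond `b`, its Wronskian with `u` would be zero at `c > b`. It is also zero at
  -- `δ / 2`, as both functions vanish at the vertex. Lagrange's identity then gives `∫ |u|² = 0`
  -- over `(δ, b]`, against `u x₁ ≠ 0`.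
  by_contra! h
  obtain ⟨c, hc, hbc⟩ := exists_mem_link_gt hb
  have hfc : wronskian u f c = 0 := by
    have hE : EqOn f 0 (link L ∩ Ioi b) := h
    have h1 : deriv f c = 0 := by
      rw [hE.deriv ((isOpen_link L).inter isOpen_Ioi) ⟨hc, hbc⟩]
      exact deriv_const c 0
    rw [wronskian, h c ⟨hc, hbc⟩, h1]
    ring
  have haδ : δ / 2 ∈ link (δ : EReal) := by
    rw [link_coe]
    constructor <;> linarith
  -- No source lives below `δ`, so there `f` extends across the vertex as a homogeneous solution.
  have hfδ : SolvesOn (link (δ : EReal)) V (fun x => z * f x) f := by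
    refine (hf.mono hδL).congr_rhs ?_
    refine (ae_restrict_iff' (isOpen_link _).measurableSet).2 (Eventually.of_forall fun x hx => ?_)
    rw [link_coe] at hx
    have : x ∉ Ioc δ b := fun h => absurd h.1 (not_lt.2 hx.2.le)
    simp [this]
  have hfa : wronskian u f (δ / 2) = 0 := by
    obtain ⟨F, hF, hfF⟩ := hfδ.exists_extension (isOpen_link _) hV haδ
    have hF0 : F 0 = 0 :=
      tendsto_nhds_unique (tendsto_vertex (by exact_mod_cast hδ) hF.continuous hfF) hf0
    have h1 := hu.wronskian_eq isOpen_univ hF (mem_univ 0) (mem_univ (δ / 2))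
    rw [wronskian, hfF haδ, hfF.deriv (isOpen_link _) haδ]
    rw [wronskian, wronskian, hu0, hF0] at h1
    simpa using h1
  set χ : ℝ → ℂ := (Ioc δ b).indicator fun y => (starRingEnd ℂ) (u y) with hχ
  have huc := hu.continuous
  have hχi : Integrable χ volume := by
    rw [hχ, integrable_indicator_iff measurableSet_Ioc]
    have : Continuous fun y => (starRingEnd ℂ) (u y) := Complex.continuous_conj.comp huc
    exact (this.integrableOn_Icc (a := δ) (b := b)).mono_set Ioc_subset_Icc_self
  have hlag := (hu.mono (subset_univ (link L))).wronskian_sub (isOpen_link L) hf (hδL haδ) hc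
    hχi.intervalIntegrable
  rw [hfc, hfa, sub_zero, zero_eq_neg] at hlag
  have hind : (fun t => u t * χ t) = (Ioc δ b).indicator fun t => ((Complex.normSq (u t) : ℝ) : ℂ) := by
    funext t
    by_cases ht : t ∈ Ioc δ b
    · simp [hχ, ht, Complex.mul_conj]
    · simp [hχ, ht]
  have hle : δ / 2 ≤ c := by linarith
  have hsub : Ioc (δ / 2) c ∩ Ioc δ b = Ioc δ b := by
    refine inter_eq_right.2 fun x hx => ⟨by linarith [hx.1], hx.2.trans (le_of_lt hbc)⟩
  rw [hind, intervalIntegral.integral_of_le hle, setIntegral_indicator measurableSet_Ioc, hsub,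
    integral_complex_ofReal, Complex.ofReal_eq_zero, ← intervalIntegral.integral_of_le hδb.le] at hlag
  have hn : Continuous fun t => Complex.normSq (u t) := Complex.continuous_normSq.comp huc
  have hpos := intervalIntegral.integral_pos hδb hn.continuousOn
    (fun t _ => Complex.normSq_nonneg (u t))
    ⟨x₁, ⟨hx₁.1.le, hx₁.2.le⟩, Complex.normSq_pos.2 hux₁⟩
  exact hpos.ne' hlag

section EndSolution

variable {N : ℕ} {ℓ : Fin N → EReal} {hℓ : ∀ j, 0 < ℓ j} {V : Fin N → ℝ → ℝ} {ω : Fin N → ℝ}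
  {z : ℂ} {R : StateSpace ℓ →L[ℂ] StateSpace ℓ}

/-- Apply the Dirichlet resolvent to `conj u` cut off to a bounded interval. Beyond the cut-off its
component solves the homogeneous equation, is square integrable and satisfies the end condition; it
is nonzero by `exists_ne_zero_beyond`, and its extension is the required solution. -/
theorem IsResolventAt.exists_isEndSolution
    (hR : IsResolventAt (hamiltonian ℓ hℓ V ω OnePoint.infty) z R)
    (hV : ∀ j, LocIntegrable (ℓ j) (V j)) (j : Fin N) :
    ∃ v, IsEndSolution (ℓ j) (V j) (ω j) z v := by
  obtain ⟨V', hV', hVV'⟩ := (hV j).exists_extension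
  obtain ⟨u, huv, hu, hu0⟩ := exists_isVertexSolution (hℓ j) hV' hVV' z
  obtain ⟨x₁, hx₁, hux₁⟩ := huv.nontrivial
  obtain ⟨b, hb, hxb⟩ := exists_mem_link_gt hx₁
  have hx0 : 0 < x₁ := hx₁.1
  have hm := (isOpen_link (ℓ j)).measurableSet
  set χ : ℝ → ℂ := (Ioc (x₁ / 2) b).indicator fun y => (starRingEnd ℂ) (u y) with hχ
  have hcc : Continuous fun y => (starRingEnd ℂ) (u y) := Complex.continuous_conj.comp hu.continuous
  have hχ2 : MemLp χ 2 (volume.restrict (link (ℓ j))) := by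
    refine MemLp.restrict _ ?_
    rw [hχ, memLp_indicator_iff_restrict measurableSet_Ioc]
    obtain ⟨C, hC⟩ := isCompact_Icc.exists_bound_of_continuousOn
      (hcc.continuousOn (s := Icc (x₁ / 2) b))
    exact MemLp.of_bound hcc.aestronglyMeasurable C ((ae_restrict_iff' measurableSet_Ioc).2
      (Eventually.of_forall fun x hx => hC x (Ioc_subset_Icc_self hx)))
  set φ : StateSpace ℓ := PiLp.single 2 j (hχ2.toLp χ) with hφ
  have hφj : φ j = hχ2.toLp χ := by simp [hφ]
  obtain ⟨f, hf, hs, he, hv⟩ := hR.acts φ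
  have hsj : SolvesOn (link (ℓ j)) V' (fun x => z * f j x + χ x) (f j) := by
    refine ((hs j).congr_rhs ?_).congr_potential hm hVV'
    filter_upwards [hf j, Lp.coeFn_add (φ j) (z • R φ j), Lp.coeFn_smul z (R φ j),
      hχ2.coeFn_toLp] with x h1 h2 h3 h4
    change (φ j + z • R φ j : Lp ℂ 2 _) x = _
    rw [h2, Pi.add_apply, h3, Pi.smul_apply, h1, smul_eq_mul, hφj, h4, add_comm]
  obtain ⟨x₂, hx₂, hfx₂⟩ := exists_ne_zero_beyond hV' hu hu0 (half_pos hx0)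
    ⟨by linarith, hxb⟩ hux₁ hb hsj (hv j)
  have hso : IsOpen (link (ℓ j) ∩ Ioi b) := (isOpen_link _).inter isOpen_Ioi
  have hst : SolvesOn (link (ℓ j) ∩ Ioi b) V' (fun x => z * f j x) (f j) := by
    refine (hsj.mono inter_subset_left).congr_rhs ?_
    refine (ae_restrict_iff' hso.measurableSet).2 (Eventually.of_forall fun x hx => ?_)
    have : x ∉ Ioc (x₁ / 2) b := fun h => absurd h.2 (not_le.2 hx.2)
    simp [hχ, this]
  obtain ⟨v, hv, hfv⟩ := hst.exists_extension hso hV' hx₂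
  refine ⟨v, (hv.mono (subset_univ _)).congr_potential hm hVV'.symm,
    ⟨x₂, hx₂.1, by rwa [← hfv hx₂]⟩, fun htop => ⟨b, hb.1, ?_⟩, ?_⟩
  · have h1 : MemLp (f j) 2 (volume.restrict (link (ℓ j))) := (Lp.memLp (R φ j)).ae_eq (hf j)
    have h2 : link (ℓ j) ∩ Ioi b = Ioi b := by
      rw [htop, link_top]
      exact inter_eq_right.2 (Ioi_subset_Ioi hb.1.le)
    refine MemLp.ae_eq ?_ (h1.mono_measure (Measure.restrict_mono_set volume
      (h2 ▸ inter_subset_left : Ioi b ⊆ link (ℓ j))))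
    exact (ae_restrict_iff' measurableSet_Ioi).2 (Eventually.of_forall fun x hx =>
      hfv (by rw [h2]; exact hx))
  · refine (he j).of_eqOn hb (e := 1) fun x hx hbx => ?_
    rw [one_mul, hfv ⟨hx, hbx⟩]

end EndSolution

/-! ### The Green function of a single link -/

/-- For a source of bounded support, the Green function of a link gives a solution of the
inhomogeneous equation. -/
theorem exists_green_solution {L : EReal} {V : ℝ → ℝ} (hV : LocallyIntegrable V volume)
    {z W : ℂ} {u v φ : ℝ → ℂ} (hu : SolvesOn univ V (fun x => z * u x) u)
    (hv : SolvesOn univ V (fun x => z * v x) v) (hu0 : u 0 = 0) (hW : wronskian u v 0 = W)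
    (hW0 : W ≠ 0) (hφ : Integrable φ volume) {b : ℝ} (hb : b ∈ link L)
    (hφb : ∀ x, x ∉ Ioc 0 b → φ x = 0) (d : ℂ) :
    ∃ H, SolvesOn univ V (fun x => z * H x + φ x) H ∧ H 0 = d * v 0 ∧
      deriv H 0 = (∫ y in link L, v y * φ y) / v 0 + d * deriv v 0 ∧
      (∀ x ∈ link L, H x = (∫ y in link L, linkGreen u v W x y * φ y) + d * v x) ∧
      ∃ e, ∀ x ∈ link L, b < x → H x = e * v x := by
  have hv0 : v 0 ≠ 0 := by
    intro h
    rw [wronskian, hu0, h] at hW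
    exact hW0 (by rw [← hW]; ring)
  have hud : deriv u 0 * v 0 = -W := by
    rw [← hW, wronskian, hu0]
    ring
  have hsub : Ioc 0 b ⊆ link L := fun x hx =>
    ⟨hx.1, lt_of_le_of_lt (by exact_mod_cast hx.2) hb.2⟩
  have hint : ∀ (g : ℝ → ℂ) (B : ℝ), b ≤ B →
      ∫ y in link L, g y * φ y = ∫ y in (0 : ℝ)..B, g y * φ y := by
    intro g B hB
    have h0B : (0 : ℝ) ≤ B := hb.1.le.trans hB
    rw [intervalIntegral.integral_of_le h0B,
      setIntegral_eq_of_subset_of_forall_sdiff_eq_zero (isOpen_link L).measurableSet hsub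
        (fun x hx => by rw [hφb x hx.2, mul_zero]),
      setIntegral_eq_of_subset_of_forall_sdiff_eq_zero measurableSet_Ioc
        (Ioc_subset_Ioc_right hB) (fun x hx => by rw [hφb x hx.2, mul_zero])]
  have hii : ∀ {g : ℝ → ℂ}, Continuous g → ∀ x y,
      IntervalIntegrable (fun t => g t * φ t) volume x y := fun hg x y =>
    (hφ.intervalIntegrable).continuousOn_mul hg.continuousOn
  have huc := hu.continuous
  have hvc := hv.continuous
  -- The initial slope is chosen so that `wronskian v H 0 = ∫ v φ`; the coefficient of `u` in `H`
  -- then vanishes beyond the support of `φ`, leaving a multiple of `v`.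
  obtain ⟨H, hH, hH0, hH1⟩ := exists_solvesOn_univ hV z hφ.locallyIntegrable 0 (d * v 0)
    ((∫ y in link L, v y * φ y) / v 0 + d * deriv v 0)
  have hval : ∀ x, H x * W = v x * (d * W - ∫ t in (0 : ℝ)..x, u t * φ t)
      - u x * ((∫ y in link L, v y * φ y) - ∫ t in (0 : ℝ)..x, v t * φ t) := by
    intro x
    have e1 := hu.wronskian_sub isOpen_univ hH (mem_univ 0) (mem_univ x) hφ.intervalIntegrable
    have e2 := hv.wronskian_sub isOpen_univ hH (mem_univ 0) (mem_univ x) hφ.intervalIntegrable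
    have e3 := wronskian_mul u v H x
    rw [hu.wronskian_eq isOpen_univ hv (mem_univ 0) (mem_univ x), hW] at e3
    have e4 : wronskian u H 0 = d * W := by
      rw [wronskian, hu0, hH0]
      linear_combination (-d) * hud
    have e5 : wronskian v H 0 = ∫ y in link L, v y * φ y := by
      rw [wronskian, hH0, hH1]
      field_simp
      ring
    rw [e3]
    rw [e4] at e1
    rw [e5] at e2
    linear_combination v x * e1 - u x * e2
  refine ⟨H, hH, hH0, hH1, fun x hx => ?_, d - (∫ y in link L, u y * φ y) / W, fun x hx hbx => ?_⟩
  · have hB := hint (linkGreen u v W x) (max b x) (le_max_left _ _)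
    have hgc : Continuous (linkGreen u v W x) := by
      unfold linkGreen
      fun_prop
    rw [← intervalIntegral.integral_add_adjacent_intervals (hii hgc 0 x) (hii hgc x _)] at hB
    have i1 : ∫ y in (0 : ℝ)..x, linkGreen u v W x y * φ y
        = -(v x / W) * ∫ y in (0 : ℝ)..x, u y * φ y := by
      rw [← intervalIntegral.integral_const_mul]
      refine intervalIntegral.integral_congr fun y hy => ?_
      rw [uIcc_of_le hx.1.le] at hy
      simp only [linkGreen, min_eq_right hy.2, max_eq_left hy.2]
      ring
    have i2 : ∫ y in x..max b x, linkGreen u v W x y * φ y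
        = -(u x / W) * ∫ y in x..max b x, v y * φ y := by
      rw [← intervalIntegral.integral_const_mul]
      refine intervalIntegral.integral_congr fun y hy => ?_
      rw [uIcc_of_le (le_max_right _ _)] at hy
      simp only [linkGreen, min_eq_left hy.1, max_eq_right hy.1]
      ring
    have hB2 := hint v (max b x) (le_max_left _ _)
    rw [← intervalIntegral.integral_add_adjacent_intervals (hii hvc 0 x) (hii hvc x _)] at hB2
    have e := hval x
    rw [hB2] at e
    rw [hB, i1, i2]
    field_simp
    linear_combination e
  · have e := hval x
    rw [← hint u x hbx.le, ← hint v x hbx.le, sub_self, mul_zero, sub_zero] at e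
    field_simp
    linear_combination e

/-! ### The resolvent on the star as an integral operator -/

/-- Solutions `u`, `v` on the line of the equation with an extended potential, from which the Green
function of a link with the Dirichlet condition at the vertex is built. -/
structure IsGreenPair (L : EReal) (V : ℝ → ℝ) (ω : ℝ) (z W : ℂ) (u v : ℝ → ℂ) : Prop where
  locallyIntegrable : LocallyIntegrable V volume
  solves_left : SolvesOn univ V (fun x => z * u x) u
  solves_right : SolvesOn univ V (fun x => z * v x) v
  left_zero : u 0 = 0
  wronskian_zero : wronskian u v 0 = W
  wronskian_ne_zero : W ≠ 0
  memLp : MemLp v 2 (volume.restrict (link L))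
  endCondition : EndCondition L ω v

theorem IsGreenPair.right_zero_ne_zero {L : EReal} {V : ℝ → ℝ} {ω : ℝ} {z W : ℂ} {u v : ℝ → ℂ}
    (P : IsGreenPair L V ω z W u v) : v 0 ≠ 0 := by
  intro h
  have hW := P.wronskian_zero
  rw [wronskian, P.left_zero, h] at hW
  exact P.wronskian_ne_zero (by rw [← hW]; ring)

/-- For `y > x` the kernel is a multiple of `v`. Square integrability in `y` at each fixed `x` makes
its product with any `L²` source integrable. -/
theorem IsGreenPair.memLp_linkGreen {L : EReal} {V : ℝ → ℝ} {ω : ℝ} {z W : ℂ} {u v : ℝ → ℂ}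
    (P : IsGreenPair L V ω z W u v) (x : ℝ) :
    MemLp (linkGreen u v W x) 2 (volume.restrict (link L)) := by
  have hu := P.solves_left.continuous
  have hv := P.solves_right.continuous
  have hc : Continuous (linkGreen u v W x) := by
    unfold linkGreen
    fun_prop
  refine memLp_link_of_eqOn hc (b := x) (e := -(u x / W)) P.memLp fun y _ hxy => ?_
  rw [linkGreen, min_eq_left hxy.le, max_eq_right hxy.le]
  ring

/-- The kernel of the resolvent on the star graph; `D` stands for `α - M`. -/
def starGreen {N : ℕ} (u v : Fin N → ℝ → ℂ) (W : Fin N → ℂ) (D : ℂ) (j l : Fin N) (x y : ℝ) : ℂ :=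
  (if j = l then linkGreen (u j) (v j) (W j) x y else 0) + v j x * v l y / (v j 0 * v l 0 * D)

section Star

variable {N : ℕ} {ℓ : Fin N → EReal} {V' : Fin N → ℝ → ℝ} {ω : Fin N → ℝ} {z D : ℂ}
  {W : Fin N → ℂ} {u v : Fin N → ℝ → ℂ}

theorem memLp_starGreen (P : ∀ j, IsGreenPair (ℓ j) (V' j) (ω j) z (W j) (u j) (v j))
    (j l : Fin N) (x : ℝ) : MemLp (starGreen u v W D j l x) 2 (volume.restrict (link (ℓ l))) := by
  have h1 : MemLp (fun y => if j = l then linkGreen (u j) (v j) (W j) x y else 0) 2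
      (volume.restrict (link (ℓ l))) := by
    by_cases h : j = l
    · subst h
      simpa using (P j).memLp_linkGreen x
    · simp [h]
  refine (h1.add ((P l).memLp.const_mul (v j x / (v j 0 * v l 0 * D)))).congr_norm ?_ ?_
  · refine h1.1.add ?_
    exact ((P l).memLp.1.const_mul (v j x)).mul_const (v j 0 * v l 0 * D)⁻¹
  · refine Eventually.of_forall fun y => ?_
    simp only [Pi.add_apply, starGreen]
    congr 2
    ring

/-- The rank-one part factors, so all links enter through a single coefficient of `v j`; it plays
the role of `d` in `exists_green_solution`. -/
theorem sum_integral_starGreen (P : ∀ j, IsGreenPair (ℓ j) (V' j) (ω j) z (W j) (u j) (v j))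
    {φ : Fin N → ℝ → ℂ} (hφ : ∀ j, MemLp (φ j) 2 (volume.restrict (link (ℓ j)))) (j : Fin N)
    (x : ℝ) :
    ∑ l, ∫ y in link (ℓ l), starGreen u v W D j l x y * φ l y =
      (∫ y in link (ℓ j), linkGreen (u j) (v j) (W j) x y * φ j y) +
        (∑ l, (∫ y in link (ℓ l), v l y * φ l y) / v l 0) / (v j 0 * D) * v j x := by
  have hi : ∀ l, Integrable (fun y => v l y * φ l y) (volume.restrict (link (ℓ l))) := fun l =>
    (P l).memLp.integrable_mul (hφ l)
  have hg : Integrable (fun y => linkGreen (u j) (v j) (W j) x y * φ j y)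
      (volume.restrict (link (ℓ j))) := ((P j).memLp_linkGreen x).integrable_mul (hφ j)
  have h1 : ∀ l, ∫ y in link (ℓ l), starGreen u v W D j l x y * φ l y =
      (if j = l then ∫ y in link (ℓ j), linkGreen (u j) (v j) (W j) x y * φ j y else 0) +
        v j x / (v j 0 * v l 0 * D) * ∫ y in link (ℓ l), v l y * φ l y := by
    intro l
    rw [← integral_const_mul]
    by_cases h : j = l
    · subst h
      simp only [if_true]
      rw [← integral_add hg ((hi j).const_mul _)]
      refine integral_congr_ae (Eventually.of_forall fun y => ?_)
      simp only [starGreen, if_true]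
      ring
    · simp only [h, if_false, zero_add]
      refine integral_congr_ae (Eventually.of_forall fun y => ?_)
      simp only [starGreen, h, if_false]
      ring
  simp_rw [h1]
  rw [Finset.sum_add_distrib, Finset.sum_ite_eq, if_pos (Finset.mem_univ j), Finset.sum_div,
    Finset.sum_mul]
  congr 1
  refine Finset.sum_congr rfl fun l _ => ?_
  rw [mul_assoc, mul_comm (v l 0) D, ← mul_assoc]
  field_simp

variable {hℓ : ∀ j, 0 < ℓ j} {V : Fin N → ℝ → ℝ} {α : ℝ} {R : StateSpace ℓ →L[ℂ] StateSpace ℓ}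

/-- The resolvent is the integral operator on sources of bounded support. -/
theorem IsResolventAt.ae_eq_starGreen
    (hR : IsResolventAt (hamiltonian ℓ hℓ V ω (α : OnePoint ℝ)) z R)
    (P : ∀ j, IsGreenPair (ℓ j) (V' j) (ω j) z (W j) (u j) (v j))
    (hVV' : ∀ j, EqOn (V j) (V' j) (link (ℓ j)))
    (hD : (α : ℂ) - ∑ j, deriv (v j) 0 / v j 0 = D) (hD0 : D ≠ 0)
    {φ : StateSpace ℓ} {χ : Fin N → ℝ → ℂ} (hφχ : ∀ j, ⇑(φ j) =ᵐ[volume.restrict (link (ℓ j))] χ j)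
    (hχ : ∀ j, Integrable (χ j) volume) {b : Fin N → ℝ} (hb : ∀ j, b j ∈ link (ℓ j))
    (hχb : ∀ j x, x ∉ Ioc 0 (b j) → χ j x = 0) (j : Fin N) :
    ⇑(R φ j) =ᵐ[volume.restrict (link (ℓ j))]
      fun x => ∑ l, ∫ y in link (ℓ l), starGreen u v W D j l x y * χ l y := by
  -- `S` is the sum of the vertex derivatives of the Dirichlet parts. The vertex condition forces
  -- the common value `S / D`, hence the multiple `S / (v j 0 * D)` of `v j`.
  set S : ℂ := ∑ l, (∫ y in link (ℓ l), v l y * χ l y) / v l 0 with hS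
  have hv0 : ∀ j, v j 0 ≠ 0 := fun j => (P j).right_zero_ne_zero
  choose H hH hH0 hH1 hHx e he using fun j => exists_green_solution (P j).locallyIntegrable
    (P j).solves_left (P j).solves_right (P j).left_zero (P j).wronskian_zero
    (P j).wronskian_ne_zero (hχ j) (hb j) (hχb j) (S / (v j 0 * D))
  have hχ2 : ∀ j, MemLp (χ j) 2 (volume.restrict (link (ℓ j))) := fun j =>
    (Lp.memLp (φ j)).ae_eq (hφχ j)
  have h := hR.ae_eq φ (f := H) (fun j => memLp_link_of_eqOn (hH j).continuous (P j).memLp (he j))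
    (fun j => ?_) (fun j => (P j).endCondition.of_eqOn (hb j) (he j)) ?_ j
  · refine h.trans ((ae_restrict_iff' (isOpen_link _).measurableSet).2
      (Eventually.of_forall fun x hx => ?_))
    beta_reduce
    rw [hHx j x hx, sum_integral_starGreen P hχ2]
  · refine (((hH j).mono (subset_univ _)).congr_potential (isOpen_link _).measurableSet
      (hVV' j).symm).congr_rhs ?_
    filter_upwards [hφχ j] with x hx
    rw [hx]
  · refine ⟨S / D, fun j => deriv (H j) 0, fun j => ?_, fun j => ?_, ?_⟩
    · have h1 := tendsto_vertex (hℓ j) (hH j).continuous (fun x (_ : x ∈ link (ℓ j)) => rfl)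
      have h2 : H j 0 = S / D := by
        rw [hH0]
        have := hv0 j
        field_simp
      rwa [h2] at h1
    · exact tendsto_vertex (hℓ j) (hH j).continuous_deriv (fun x (_ : x ∈ link (ℓ j)) => rfl)
    · have h1 : ∀ j, deriv (H j) 0 = (∫ y in link (ℓ j), v j y * χ j y) / v j 0
          + S / D * (deriv (v j) 0 / v j 0) := by
        intro j
        rw [hH1]
        have := hv0 j
        field_simp
      simp_rw [h1]
      rw [Finset.sum_add_distrib, ← Finset.mul_sum, ← hS]
      have h2 : ∑ j, deriv (v j) 0 / v j 0 = α - D := by rw [← hD]; ring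
      rw [h2]
      field_simp
      ring

/-- The resolvent is the matrix integral operator with the kernel `starGreen`. -/
theorem IsResolventAt.isMatrixIntegralOperator_starGreen
    (hR : IsResolventAt (hamiltonian ℓ hℓ V ω (α : OnePoint ℝ)) z R)
    (P : ∀ j, IsGreenPair (ℓ j) (V' j) (ω j) z (W j) (u j) (v j))
    (hVV' : ∀ j, EqOn (V j) (V' j) (link (ℓ j)))
    (hD : (α : ℂ) - ∑ j, deriv (v j) 0 / v j 0 = D) (hD0 : D ≠ 0) :
    IsMatrixIntegralOperator ℓ R (starGreen u v W D) := by
  intro φ j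
  have hint : ∀ l x, IntegrableOn (fun y => starGreen u v W D j l x y * φ l y) (link (ℓ l)) :=
    fun l x => (memLp_starGreen P j l x).integrable_mul (Lp.memLp (φ l))
  choose b hb hbx using fun j => exists_exhaustion (hℓ j)
  have hsub : ∀ l n, Ioc 0 (b l n) ⊆ link (ℓ l) := fun l n x hx =>
    ⟨hx.1, lt_of_le_of_lt (by exact_mod_cast hx.2) (hb l n).2⟩
  set χ : ℕ → Fin N → ℝ → ℂ := fun n l => (Ioc 0 (b l n)).indicator (φ l) with hχdef
  have hχ2 : ∀ n l, MemLp (χ n l) 2 (volume.restrict (link (ℓ l))) := fun n l =>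
    (Lp.memLp (φ l)).indicator measurableSet_Ioc
  have hmem : ∀ l, ∀ x ∈ link (ℓ l), ∀ᶠ n in atTop, x ∈ Ioc 0 (b l n) := fun l x hx => by
    filter_upwards [hbx l x hx] with n hn
    exact ⟨hx.1, hn⟩
  set Φ : ℕ → StateSpace ℓ := fun n => WithLp.toLp 2 fun l => (hχ2 n l).toLp (χ n l) with hΦ
  have hΦlim : Tendsto Φ atTop (𝓝 φ) := by
    have h1 : Tendsto (fun n l => (hχ2 n l).toLp (χ n l)) atTop (𝓝 fun l => φ l) := by
      refine tendsto_pi_nhds.2 fun l => ?_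
      have := tendsto_toLp_indicator (Lp.memLp (φ l)) (s := fun n => Ioc 0 (b l n))
        (fun n => measurableSet_Ioc)
        ((ae_restrict_iff' (isOpen_link _).measurableSet).2 (Eventually.of_forall (hmem l)))
      rwa [Lp.toLp_coeFn] at this
    exact ((PiLp.continuous_toLp 2 _).tendsto _).comp h1
  have hχi : ∀ n l, Integrable (χ n l) volume := fun n l => by
    rw [hχdef, integrable_indicator_iff measurableSet_Ioc]
    exact ((Lp.memLp (φ l)).mono_measure
      (Measure.restrict_mono_set volume (hsub l n))).integrable (by norm_num)
  have hRn : ∀ n, ⇑(R (Φ n) j) =ᵐ[volume.restrict (link (ℓ j))]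
      fun x => ∑ l, ∫ y in link (ℓ l), starGreen u v W D j l x y * χ n l y := fun n =>
    hR.ae_eq_starGreen P hVV' hD hD0 (fun l => (hχ2 n l).coeFn_toLp) (hχi n) (fun l => hb l n)
      (fun l x hx => indicator_of_notMem hx _) j
  have hRlim : Tendsto (fun n => R (Φ n) j) atTop (𝓝 (R φ j)) :=
    ((PiLp.continuous_apply 2 _ j).tendsto _).comp ((R.continuous.tendsto φ).comp hΦlim)
  -- Convergence in `L²` yields pointwise limits only along a subsequence. That suffices, since the
  -- integrals converge along the full sequence at every `x`.
  obtain ⟨ns, hns, hae⟩ := (tendstoInMeasure_of_tendsto_Lp hRlim).exists_seq_tendsto_ae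
  filter_upwards [hae, ae_all_iff.2 hRn] with x h1 h2
  refine ⟨fun l => hint l x, ?_⟩
  refine tendsto_nhds_unique h1 ?_
  simp_rw [h2]
  refine Tendsto.comp (g := fun n => ∑ l, ∫ y in link (ℓ l), starGreen u v W D j l x y * χ n l y)
    ?_ hns.tendsto_atTop
  refine tendsto_finsetSum _ fun l _ => ?_
  refine tendsto_integral_of_dominated_convergence
    (fun y => ‖starGreen u v W D j l x y * φ l y‖)
    (fun n => ((memLp_starGreen P j l x).integrable_mul (hχ2 n l)).1) (hint l x).norm
    (fun n => Eventually.of_forall fun y => ?_) ?_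
  · rw [norm_mul, norm_mul]
    gcongr
    exact norm_indicator_le_norm_self _ _
  · refine (ae_restrict_iff' (isOpen_link _).measurableSet).2 (Eventually.of_forall fun y hy => ?_)
    refine tendsto_const_nhds.congr' ?_
    filter_upwards [hmem l y hy] with n hn
    simp only [hχdef, indicator_of_mem hn]

end Star

/-! ### Nonvanishing of `v_j(0)` and of `α - M` -/

section Eigenfunctions

variable {N : ℕ} {ℓ : Fin N → EReal} {hℓ : ∀ j, 0 < ℓ j} {V : Fin N → ℝ → ℝ} {ω : Fin N → ℝ}
  {z : ℂ} {R : StateSpace ℓ →L[ℂ] StateSpace ℓ}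

/-- At a point of the resolvent set of the Dirichlet operator, end solutions do not vanish at the
vertex. -/
theorem IsResolventAt.endSolution_zero_ne_zero
    (hR : IsResolventAt (hamiltonian ℓ hℓ V ω OnePoint.infty) z R) {j : Fin N} {v : ℝ → ℂ}
    (hc : Continuous v) (hs : SolvesOn (link (ℓ j)) (V j) (fun x => z * v x) v)
    (h2 : MemLp v 2 (volume.restrict (link (ℓ j)))) (he : EndCondition (ℓ j) (ω j) v)
    (hne : ∃ x ∈ link (ℓ j), v x ≠ 0) : v 0 ≠ 0 := by
  intro h0
  have hzero : ∀ i, EndCondition (ℓ i) (ω i) (fun _ => 0) := fun i c _ =>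
    ⟨0, 0, tendsto_const_nhds, by simp, by simp⟩
  -- Dirichlet conditions decouple the links, so `v` continued by zero to the other links would be
  -- an eigenfunction.
  have h := hR.eqOn_zero (f := fun i => if i = j then v else fun _ => 0) (fun i => ?_) (fun i => ?_)
    (fun i => ?_) (fun i => ?_) j
  · obtain ⟨x, hx, hvx⟩ := hne
    have := h hx
    simp only [if_true] at this
    exact hvx this
  · by_cases hi : i = j
    · subst hi
      simpa using h2
    · simp [hi]
  · by_cases hi : i = j
    · subst hi
      simpa using hs
    · simp only [hi, if_false, mul_zero]
      exact SolvesOn.zero (ℓ i) (V i)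
  · by_cases hi : i = j
    · subst hi
      simpa using he
    · simpa [hi] using hzero i
  · by_cases hi : i = j
    · subst hi
      have := tendsto_vertex (hℓ i) hc (fun x (_ : x ∈ link (ℓ i)) => rfl)
      rw [h0] at this
      simpa using this
    · simp [hi]

/-- At a common point of the resolvent sets, `α` differs from the sum of the logarithmic
derivatives of the end solutions. -/
theorem IsResolventAt.sub_sum_ne_zero [NeZero N] {α : ℝ}
    (hR : IsResolventAt (hamiltonian ℓ hℓ V ω (α : OnePoint ℝ)) z R) {v : Fin N → ℝ → ℂ}
    (hc : ∀ j, Continuous (v j)) (hc' : ∀ j, Continuous (deriv (v j)))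
    (hs : ∀ j, SolvesOn (link (ℓ j)) (V j) (fun x => z * v j x) (v j))
    (h2 : ∀ j, MemLp (v j) 2 (volume.restrict (link (ℓ j))))
    (he : ∀ j, EndCondition (ℓ j) (ω j) (v j)) (hne : ∀ j, ∃ x ∈ link (ℓ j), v j x ≠ 0)
    (h0 : ∀ j, v j 0 ≠ 0) : (α : ℂ) - ∑ j, deriv (v j) 0 / v j 0 ≠ 0 := by
  intro hα
  -- Normalised to the value `1` at the vertex, the end solutions have derivative sum `M`; if `α =
  -- M` they form an eigenfunction, nonzero on link `0`.
  have h := hR.eqOn_zero (f := fun j x => (v j 0)⁻¹ * v j x) (fun j => (h2 j).const_mul _)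
    (fun j => ?_) (fun j => ?_) ?_ 0
  · obtain ⟨x, hx, hvx⟩ := hne 0
    exact mul_ne_zero (inv_ne_zero (h0 0)) hvx (h hx)
  · refine ((hs j).smul (v j 0)⁻¹).congr_rhs (Eventually.of_forall fun x => ?_)
    simp only [Pi.smul_apply, smul_eq_mul]
    ring
  · obtain ⟨b, hb⟩ := link_nonempty (hℓ j)
    exact (he j).of_eqOn hb fun x _ _ => rfl
  · refine ⟨1, fun j => (v j 0)⁻¹ * deriv (v j) 0, fun j => ?_, fun j => ?_, ?_⟩
    · have := (tendsto_vertex (hℓ j) (hc j) (fun x (_ : x ∈ link (ℓ j)) => rfl)).const_mul (v j 0)⁻¹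
      rwa [inv_mul_cancel₀ (h0 j)] at this
    · have := (tendsto_vertex (hℓ j) (hc' j)
        (fun x (_ : x ∈ link (ℓ j)) => rfl)).const_mul (v j 0)⁻¹
      refine this.congr fun x => ?_
      rw [deriv_const_mul_field]
    · rw [mul_one, sub_eq_zero.1 hα]
      refine Finset.sum_congr rfl fun j _ => ?_
      rw [div_eq_mul_inv, mul_comm]

end Eigenfunctions

end StarGraph

end

/-! ### The main theorem -/

theorem mainTheorem4 (N : ℕ) (hN : 2 ≤ N) (ℓ : Fin N → EReal) (hℓ : ∀ j, 0 < ℓ j)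
    (V : Fin N → ℝ → ℝ) (ω : Fin N → ℝ)
    (hp1 : ∀ j, StarGraph.LocIntegrable (ℓ j) (V j))
    (hp2 : ∀ j, ℓ j = ⊤ → StarGraph.LimitPointAtInfinity (V j))
    (α : ℝ) (k : ℂ) (hk : 0 ≤ k.im)
    (hk_inf : k ^ 2 ∈ StarGraph.resolventSet (StarGraph.hamiltonian ℓ hℓ V ω OnePoint.infty))
    (hk_α : k ^ 2 ∈ StarGraph.resolventSet (StarGraph.hamiltonian ℓ hℓ V ω (α : OnePoint ℝ))) :
    -- the solutions exist on each link,
    (∀ j, (∃ u, StarGraph.IsVertexSolution (ℓ j) (V j) (k ^ 2) u) ∧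
      ∃ v, StarGraph.IsEndSolution (ℓ j) (V j) (ω j) (k ^ 2) v) ∧
    -- and for any choice of them the ingredients of the kernel are well defined
    ∀ u v : Fin N → ℝ → ℂ,
      (∀ j, StarGraph.IsVertexSolution (ℓ j) (V j) (k ^ 2) (u j)) →
      (∀ j, StarGraph.IsEndSolution (ℓ j) (V j) (ω j) (k ^ 2) (v j)) →
      ∃ v₀ v₀' W : Fin N → ℂ,
        (∀ j, Tendsto (v j) (𝓝[>] 0) (𝓝 (v₀ j)) ∧ v₀ j ≠ 0) ∧
        (∀ j, Tendsto (deriv (v j)) (𝓝[>] 0) (𝓝 (v₀' j))) ∧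
        (∀ j, (∀ x ∈ StarGraph.link (ℓ j), StarGraph.wronskian (u j) (v j) x = W j) ∧ W j ≠ 0) ∧
        (α : ℂ) - ∑ j, v₀' j / v₀ j ≠ 0 ∧
        -- and the resolvent is the matrix integral operator with this kernel
        ∀ R : StarGraph.StateSpace ℓ →L[ℂ] StarGraph.StateSpace ℓ,
          StarGraph.IsResolventAt (StarGraph.hamiltonian ℓ hℓ V ω (α : OnePoint ℝ)) (k ^ 2) R →
          StarGraph.IsMatrixIntegralOperator ℓ R (fun j l x y =>
            (if j = l then StarGraph.linkGreen (u j) (v j) (W j) x y else 0) +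
              v j x * v l y / (v₀ j * v₀ l * ((α : ℂ) - ∑ i, v₀' i / v₀ i))) := by
  obtain ⟨R₀, hR₀⟩ := hk_inf
  obtain ⟨Rα, hRα⟩ := hk_α
  choose V' hV' hVV' using fun j => (hp1 j).exists_extension
  have hm : ∀ j, MeasurableSet (StarGraph.link (ℓ j)) := fun j =>
    (StarGraph.isOpen_link _).measurableSet
  refine ⟨fun j => ⟨?_, hR₀.exists_isEndSolution hp1 j⟩, fun u v hu hv => ?_⟩
  · obtain ⟨u, hu, -, -⟩ := StarGraph.exists_isVertexSolution (hℓ j) (hV' j) (hVV' j) (k ^ 2)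
    exact ⟨u, hu⟩
  -- The given `u j`, `v j` are controlled only on the link. They are replaced by solutions `U j`,
  -- `F j` on the line that agree with them there.
  have hext : ∀ j (f : ℝ → ℂ),
      StarGraph.SolvesOn (StarGraph.link (ℓ j)) (V j) (fun x => k ^ 2 * f x) f →
      ∃ F, StarGraph.SolvesOn univ (V' j) (fun x => k ^ 2 * F x) F ∧
        EqOn f F (StarGraph.link (ℓ j)) := fun j f hf =>
    (hf.congr_potential (hm j) (hVV' j)).exists_extension (StarGraph.isOpen_link _) (hV' j)
      (StarGraph.link_nonempty (hℓ j)).some_mem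
  choose U hU huU using fun j => hext j (u j) (hu j).solves
  choose F hF hvF using fun j => hext j (v j) (hv j).solves
  have hU0 : ∀ j, U j 0 = 0 := fun j => tendsto_nhds_unique
    (StarGraph.tendsto_vertex (hℓ j) (hU j).continuous (huU j)) (hu j).vertex
  have hF2 : ∀ j, MemLp (F j) 2 (volume.restrict (StarGraph.link (ℓ j))) := fun j =>
    StarGraph.memLp_link_of_sqIntegrable (hℓ j) (hF j).continuous (hvF j) (hv j).sqIntegrable
  have hFe : ∀ j, StarGraph.EndCondition (ℓ j) (ω j) (F j) := fun j => by
    obtain ⟨b, hb⟩ := StarGraph.link_nonempty (hℓ j)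
    exact (hv j).endCondition.of_eqOn hb (e := 1) fun x hx _ => by rw [one_mul, hvF j hx]
  have hFs : ∀ j, StarGraph.SolvesOn (StarGraph.link (ℓ j)) (V j) (fun x => k ^ 2 * F j x) (F j) :=
    fun j => ((hF j).mono (subset_univ _)).congr_potential (hm j) (hVV' j).symm
  have hFn : ∀ j, ∃ x ∈ StarGraph.link (ℓ j), F j x ≠ 0 := fun j => by
    obtain ⟨x, hx, h⟩ := (hv j).nontrivial
    exact ⟨x, hx, by rwa [← hvF j hx]⟩
  have hF0 : ∀ j, F j 0 ≠ 0 := fun j =>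
    hR₀.endSolution_zero_ne_zero (hF j).continuous (hFs j) (hF2 j) (hFe j) (hFn j)
  have hU1 : ∀ j, deriv (U j) 0 ≠ 0 := fun j h => by
    obtain ⟨x, hx, hux⟩ := (hu j).nontrivial
    rw [huU j hx] at hux
    exact hux ((hU j).eq_zero (hV' j) (hU0 j) h x)
  have hW : ∀ j, StarGraph.wronskian (U j) (F j) 0 ≠ 0 := fun j => by
    rw [StarGraph.wronskian, hU0, zero_mul, zero_sub]
    exact neg_ne_zero.2 (mul_ne_zero (hU1 j) (hF0 j))
  have : NeZero N := ⟨by omega⟩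
  have hD := hRα.sub_sum_ne_zero (fun j => (hF j).continuous) (fun j => (hF j).continuous_deriv)
    hFs hF2 hFe hFn hF0
  have P : ∀ j, StarGraph.IsGreenPair (ℓ j) (V' j) (ω j) (k ^ 2)
      (StarGraph.wronskian (U j) (F j) 0) (U j) (F j) := fun j =>
    ⟨hV' j, hU j, hF j, hU0 j, rfl, hW j, hF2 j, hFe j⟩
  refine ⟨fun j => F j 0, fun j => deriv (F j) 0, fun j => StarGraph.wronskian (U j) (F j) 0,
    fun j => ⟨StarGraph.tendsto_vertex (hℓ j) (hF j).continuous (hvF j), hF0 j⟩,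
    fun j => StarGraph.tendsto_vertex (hℓ j) (hF j).continuous_deriv
      ((hvF j).deriv (StarGraph.isOpen_link _)),
    fun j => ⟨fun x hx => ?_, hW j⟩, hD, fun R hR φ j => ?_⟩
  · beta_reduce
    rw [← (hU j).wronskian_eq isOpen_univ (hF j) (mem_univ 0) (mem_univ x), StarGraph.wronskian,
      StarGraph.wronskian, huU j hx, hvF j hx, (huU j).deriv (StarGraph.isOpen_link _) hx,
      (hvF j).deriv (StarGraph.isOpen_link _) hx]
  · filter_upwards [hR.isMatrixIntegralOperator_starGreen P hVV' rfl hD φ j,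
      ae_restrict_mem (hm j)] with x hx hxj
    -- The two kernels agree for `x`, `y` in the links, which is all that the integrals see.
    have hG : ∀ l, ∀ y ∈ StarGraph.link (ℓ l),
        StarGraph.starGreen U F (fun j => StarGraph.wronskian (U j) (F j) 0)
          ((α : ℂ) - ∑ i, deriv (F i) 0 / F i 0) j l x y * φ l y =
        ((if j = l then StarGraph.linkGreen (u j) (v j) (StarGraph.wronskian (U j) (F j) 0) x y
          else 0) + v j x * v l y / (F j 0 * F l 0 * ((α : ℂ) - ∑ i, deriv (F i) 0 / F i 0)))
          * φ l y := by
      intro l y hy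
      rw [StarGraph.starGreen, hvF j hxj, hvF l hy]
      by_cases h : j = l
      · subst h
        have hmin : min x y ∈ StarGraph.link (ℓ j) := by
          rcases min_choice x y with h | h <;> rw [h] <;> assumption
        have hmax : max x y ∈ StarGraph.link (ℓ j) := by
          rcases max_choice x y with h | h <;> rw [h] <;> assumption
        rw [StarGraph.linkGreen, StarGraph.linkGreen, huU j hmin, hvF j hmax]
      · simp only [h, if_false]
    refine ⟨fun l => (hx.1 l).congr_fun (hG l) (hm l), hx.2.trans ?_⟩
    exact Finset.sum_congr rfl fun l _ => setIntegral_congr_fun (hm l) (hG l)
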